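/- **Setting.** Let $(l_i)_{i\ge 0}$ be a bounded sequence of positive integers, $\mathcal A_i=\{1,\dots,l_i\}$, and let $L_i$ ($i\ge0$) be $l_i\times l_{i+1}$ matrices with entries in $\{0,1\}$, none of which has a zero row or a zero column. For $k\le n$ put $L^{(k,n)}=L_kL_{k+1}\cdots L_{n-1}$ (with $L^{(k,k)}$ the identity), and assume that $(L_i)$ is primitive: for every $i$ there is $n>i$ such that all entries of $L^{(i,n)}$ are positive. For $n\le m$ let $w(n,m)$ be the number of admissible words $(x_n,\dots,x_m)$, i.e. $x_i\in\mathcal A_i$ and $(L_i)_{x_ix_{i+1}}=1$ for $n\le i<m$. Let $\Sigma^k$ be the space of sequences $x=(x_k,x_{k+1},\dots)$ with $x_i\in\mathcal A_i$ and $(L_i)_{x_ix_{i+1}}=1$ for all $i\ge k$, with the metric $d_k(x,y)=0$ if $x=y$, $d_k(x,y)=1$ if $x_k\ne y_k$, and otherwise $d_k(x,y)=w(k,l)^{-1}$, where $l$ is the largest $r\ge k$ with $x_i=y_i$ for $k\le i\le r$. Let $\sigma_k:\Sigma^k\to\Sigma^{k+1}$ be the left shift and $\sigma_0^n=\sigma_{n-1}\circ\cdots\circ\sigma_0$.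 The system $(\Sigma^k,\sigma_k)_{k\ge0}$ is called a nonstationary subshift of finite type (NSFT). **Parry IMS.** Choose strictly positive column vectors $\hat w_i\in\mathbb R^{l_i}$ with $\hat w_i=L_i\hat w_{i+1}$ and strictly positive row vectors $\hat v_i$ with $\hat v_iL_i=\hat v_{i+1}$ ($i\ge0$). With $\|u\|=\sum_\alpha|u_\alpha|$ put $w_i=\hat w_i/\|\hat w_i\|$, $v_i=\hat v_i/(\hat v_iw_i)$, $\lambda_i=\|\hat w_i\|/\|\hat w_{i+1}\|$, $(\pi_i)_\alpha=(v_i)_\alpha(w_i)_\alpha$ and $P_i=\lambda_i^{-1}W_i^{-1}L_iW_{i+1}$, where $W_i$ is the diagonal matrix of $w_i$. The associated Parry invariant measure sequence (Parry IMS) $\mu_\infty=(\mu_k)_{k\ge0}$ consists of the Borel probability measures on $\Sigma^k$ with $$\mu_k(\{y\in\Sigma^k: y_i=x_i,\ k\le i\le m\})=(\pi_k)_{x_k}(P_k)_{x_kx_{k+1}}\cdots(P_{m-1})_{x_{m-1}x_m}.$$ **Entropies.** $h_{\mathrm{top}}(\sigma_\infty)$ is the supremum of $\limsup_{n}\frac1n\log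 N\big(\bigvee_{i=0}^{n-1}(\sigma_0^i)^{-1}\mathcal U_i\big)$ over all sequences of open covers $\mathcal U_i$ of $\Sigma^i$ whose Lebesgue numbers are bounded away from $0$, where $N$ is the minimal cardinality of a finite subcover. $h(\sigma_\infty,\mu_\infty)$ is the supremum of $\limsup_n\frac1nH_{\mu_0}\big(\bigvee_{i=0}^{n-1}(\sigma_0^i)^{-1}\mathcal P_i\big)$, where $H_{\mu_0}(\mathcal P)=-\sum_{P\in\mathcal P}\mu_0(P)\log\mu_0(P)$, over all admissible sequences of finite Borel partitions $\mathcal P_n=\{P_{n,1},\dots,P_{n,k_n}\}$ of $\Sigma^n$. Admissible means that $(k_n)$ is bounded and that for every $\varepsilon>0$ there are $\delta>0$ and compact sets $K_{n,i}\subset P_{n,i}$ such that for all $n$, $\mu_n(P_{n,i}\setminus K_{n,i})\le\varepsilon$ for all $i$, and $d_n(x,y)\ge\delta$ whenever $x\in K_{n,i}$, $y\in K_{n,j}$, $i\ne j$. **Notation.** For $\varepsilon>0$ and $k\ge0$ let $m_k(\varepsilon)=\min\{m\ge0: w(k,k+m)>1/\varepsilon\}$ (read as $0$ if there is no such $m$,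 which for some $\varepsilon$ happens only if $\Sigma^0$ is finite), $n_k(\varepsilon)=k+m_k(\varepsilon)$ and $\widetilde n_k(\varepsilon)=\max_{0\le i\le k}(i+m_i(\varepsilon))$. We say that $\gamma\in\mathcal A_k$ maximizes $\sum_\alpha L^{(0,k)}_{\alpha\gamma}$ if $\sum_\alpha L^{(0,k)}_{\alpha\gamma}\ge\sum_\alpha L^{(0,k)}_{\alpha\beta}$ for all $\beta\in\mathcal A_k$. **Theorem.** Let $\mu_\infty$ be a Parry IMS of the NSFT given by a primitive sequence $(L_i)$ as above. (i) $$h(\sigma_\infty,\mu_\infty)=\lim_{\varepsilon\searrow0}\limsup_{k\to\infty}\frac1k\sum_{\beta}(\pi_{\widetilde n_k(\varepsilon)})_\beta\log\sum_\alpha L^{(0,\widetilde n_k(\varepsilon))}_{\alpha\beta}.$$ (ii) Suppose that for every $\delta\in(0,1)$ there exist $\varepsilon>0$ and $k_0\in\mathbb N$ such that for all $k\ge k_0$ and each $\gamma\in\mathcal A_k$ that maximizes $\sum_\alpha L^{(0,k)}_{\alpha\gamma}$ there is a set $B\subset\mathcal A_{n_k(\varepsilon)}$ with $\sum_{\beta\in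 B}(\pi_{n_k(\varepsilon)})_\beta\ge1-\delta$ and $L^{(k,n_k(\varepsilon))}_{\gamma\beta}\ge1$ for all $\beta\in B$. Then $h(\sigma_\infty,\mu_\infty)=h_{\mathrm{top}}(\sigma_\infty)$. -/

import Mathlib

open Filter Topology MeasureTheory

/-! Nonautonomous dynamical systems: topological and metric entropy -/

namespace NDS

noncomputable section

/-- The iterate `f_0^n = f_{n-1} ∘ ⋯ ∘ f_0 : X_0 → X_n`. -/
def iter {X : ℕ → Type*} (f : ∀ n, X n → X (n + 1)) : ∀ n, X 0 → X n
  | 0 => id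
  | n + 1 => f n ∘ iter f n

/-- A sequence of open covers `𝒰_n` of `X_n` whose Lebesgue numbers are bounded away from zero. -/
structure IsLebesgueCoverSeq {X : ℕ → Type*} [∀ n, MetricSpace (X n)]
    (U : ∀ n, Set (Set (X n))) : Prop where
  isOpen : ∀ n, ∀ V ∈ U n, IsOpen V
  cover : ∀ n, ⋃₀ U n = Set.univ
  lebesgue : ∃ δ : ℝ, 0 < δ ∧ ∀ n, ∀ x : X n, ∃ V ∈ U n, Metric.ball x δ ⊆ V

/-- The join `⋁_{i<n} f_0^{-i} 𝒰_i`. -/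
def joinCover {X : ℕ → Type*} (f : ∀ n, X n → X (n + 1)) (U : ∀ n, Set (Set (X n))) (n : ℕ) :
    Set (Set (X 0)) :=
  {A | ∃ V : ∀ i, Set (X i), (∀ i < n, V i ∈ U i) ∧ A = ⋂ i < n, iter f i ⁻¹' V i}

/-- Minimal number of elements of a finite subcover of the cover `C`. -/
def minSubcover {Y : Type*} (C : Set (Set Y)) : ℕ :=
  sInf {m : ℕ | ∃ D : Finset (Set Y), (D : Set (Set Y)) ⊆ C ∧ ⋃₀ (D : Set (Set Y)) = Set.univ ∧
    D.card = m}

/-- `h_top(f_∞; 𝒰_∞) = limsup (1/n) log N(⋁_{i<n} f_0^{-i} 𝒰_i)`. -/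
def coverEntropy {X : ℕ → Type*} (f : ∀ n, X n → X (n + 1)) (U : ∀ n, Set (Set (X n))) : EReal :=
  limsup (fun n : ℕ => ((1 / (n : ℝ) * Real.log (minSubcover (joinCover f U n)) : ℝ) : EReal)) atTop

/-- The topological entropy `h_top(f_∞)`. -/
def topEntropy {X : ℕ → Type*} [∀ n, MetricSpace (X n)] (f : ∀ n, X n → X (n + 1)) : EReal :=
  ⨆ (U : ∀ n, Set (Set (X n))) (_ : IsLebesgueCoverSeq U), coverEntropy f U

/-- A sequence of finite Borel partitions `𝒫_n = {P_{n,1}, …, P_{n,k_n}}` of `X_n`.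
Empty cells are allowed; they contribute nothing to entropies. -/
structure PartitionSeq (X : ℕ → Type*) [∀ n, MeasurableSpace (X n)] where
  card : ℕ → ℕ
  cell : ∀ n, Fin (card n) → Set (X n)
  measurable : ∀ n i, MeasurableSet (cell n i)
  disjoint : ∀ n, Pairwise fun i j => Disjoint (cell n i) (cell n j)
  cover : ∀ n, ⋃ i, cell n i = Set.univ

/-- Admissibility of a sequence of partitions with respect to `μ_∞`. -/
structure Admissible {X : ℕ → Type*} [∀ n, MetricSpace (X n)] [∀ n, MeasurableSpace (X n)]
    (μ : ∀ n, Measure (X n)) (P : PartitionSeq X) : Prop where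
  card_bdd : BddAbove (Set.range P.card)
  compacts : ∀ ε : ℝ, 0 < ε → ∃ δ : ℝ, 0 < δ ∧ ∃ K : ∀ n, Fin (P.card n) → Set (X n),
    (∀ n i, IsCompact (K n i) ∧ K n i ⊆ P.cell n i ∧
      μ n (P.cell n i \ K n i) ≤ ENNReal.ofReal ε) ∧
    ∀ n i j, i < j → ∀ x ∈ K n i, ∀ y ∈ K n j, δ ≤ dist x y

/-- The Shannon entropy `H_{μ_0}(⋁_{i<n} f_0^{-i} 𝒫_i)`. The cells of the join are indexed by the
choices `s` of one cell from each `𝒫_i`, `i < n`. -/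
def joinEntropy {X : ℕ → Type*} [∀ n, MeasurableSpace (X n)] (f : ∀ n, X n → X (n + 1))
    (μ : ∀ n, Measure (X n)) (P : PartitionSeq X) (n : ℕ) : ℝ :=
  ∑ s : (∀ i : Fin n, Fin (P.card i)),
    Real.negMulLog ((μ 0).real (⋂ i : Fin n, iter f i ⁻¹' P.cell i (s i)))

/-- `h(f_∞, μ_∞; 𝒫_∞) = limsup (1/n) H_{μ_0}(⋁_{i<n} f_0^{-i} 𝒫_i)`. -/
def partitionEntropy {X : ℕ → Type*} [∀ n, MeasurableSpace (X n)] (f : ∀ n, X n → X (n + 1))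
    (μ : ∀ n, Measure (X n)) (P : PartitionSeq X) : EReal :=
  limsup (fun n : ℕ => ((1 / (n : ℝ) * joinEntropy f μ P n : ℝ) : EReal)) atTop

/-- The metric entropy `h(f_∞, μ_∞)`, the supremum over admissible sequences of partitions. -/
def metricEntropy {X : ℕ → Type*} [∀ n, MetricSpace (X n)] [∀ n, MeasurableSpace (X n)]
    (f : ∀ n, X n → X (n + 1)) (μ : ∀ n, Measure (X n)) : EReal :=
  ⨆ (P : PartitionSeq X) (_ : Admissible μ P), partitionEntropy f μ P

end

end NDS

/-! Nonstationary subshifts of finite type -/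

/-- A reduced sequence of 0-1-matrices `L_i` of sizes `l_i × l_{i+1}` with `(l_i)` bounded;
the alphabet `𝒜_i` is `Fin (l i)`. -/
structure NSFT where
  l : ℕ → ℕ
  L : ∀ i, Matrix (Fin (l i)) (Fin (l (i + 1))) ℝ
  l_pos : ∀ i, 0 < l i
  zero_one : ∀ i a b, L i a b = 0 ∨ L i a b = 1
  row_ne_zero : ∀ i a, ∃ b, L i a b ≠ 0
  col_ne_zero : ∀ i b, ∃ a, L i a b ≠ 0
  l_bdd : BddAbove (Set.range l)

namespace NSFT

noncomputable section

/-- `L^{(k,n)} = L_k L_{k+1} ⋯ L_{n-1}` for `k ≤ n` (the identity for `n = k`). -/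
def matProd (S : NSFT) {k n : ℕ} (h : k ≤ n) : Matrix (Fin (S.l k)) (Fin (S.l n)) ℝ :=
  Nat.leRec (motive := fun n _ => Matrix (Fin (S.l k)) (Fin (S.l n)) ℝ)
    1 (fun n _ M => M * S.L n) h

theorem matProd_self (S : NSFT) (k : ℕ) : S.matProd (le_refl k) = 1 :=
  Nat.leRec_self _ _

theorem matProd_succ (S : NSFT) {k n : ℕ} (h : k ≤ n) :
    S.matProd (Nat.le_succ_of_le h) = S.matProd h * S.L n :=
  Nat.leRec_succ _ _ h

/-- The matrix sequence is primitive. -/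
def Primitive (S : NSFT) : Prop :=
  ∀ i, ∃ n, ∃ h : i < n, ∀ a b, 0 < S.matProd h.le a b

/-- Tuples `(x_n, …, x_m)` with `x_i ∈ 𝒜_i`. -/
abbrev Word (S : NSFT) (n m : ℕ) : Type := (i : Set.Icc n m) → Fin (S.l i)

/-- The admissible words `(x_n, …, x_m)`. -/
def admWords (S : NSFT) (n m : ℕ) : Set (S.Word n m) :=
  {x | ∀ (i : ℕ) (hn : n ≤ i) (hm : i + 1 ≤ m),
    S.L i (x ⟨i, hn, by omega⟩) (x ⟨i + 1, by omega, hm⟩) = 1}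

/-- `w(n,m)`, the number of admissible words. -/
def w (S : NSFT) (n m : ℕ) : ℕ := (S.admWords n m).ncard

/-- The space `Σ_{(L)}^{k,+}` of admissible sequences `(x_k, x_{k+1}, …)`. -/
@[ext] structure Space (S : NSFT) (k : ℕ) where
  seq : (i : Set.Ici k) → Fin (S.l i)
  adm : ∀ (i : ℕ) (hi : k ≤ i),
    S.L i (seq ⟨i, hi⟩) (seq ⟨i + 1, Nat.le_succ_of_le hi⟩) = 1

/-- The shift `σ_k(x_k, x_{k+1}, x_{k+2}, …) = (x_{k+1}, x_{k+2}, …)`. -/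
def shift (S : NSFT) (k : ℕ) (x : S.Space k) : S.Space (k + 1) where
  seq i := x.seq ⟨i, Nat.le_of_succ_le i.2⟩
  adm i hi := x.adm i (Nat.le_of_succ_le hi)

/-- The set of `r ≥ k` such that `x_i = y_i` for `i = k, …, r`. -/
def agreeSet (S : NSFT) {k : ℕ} (x y : S.Space k) : Set ℕ :=
  {r | k ≤ r ∧ ∀ i : Set.Ici k, (i : ℕ) ≤ r → x.seq i = y.seq i}

open Classical in
/-- The metric `d_k`: zero if `x = y`, one if `x_k ≠ y_k`, and otherwise `w(k,l)⁻¹` where `l` is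
the largest `r ≥ k` such that `x` and `y` agree in positions `k, …, r`. -/
def spaceDist (S : NSFT) {k : ℕ} (x y : S.Space k) : ℝ :=
  if x = y then 0
  else if x.seq ⟨k, le_refl k⟩ ≠ y.seq ⟨k, le_refl k⟩ then 1
  else ((S.w k (sSup (S.agreeSet x y)) : ℕ) : ℝ)⁻¹

theorem w_mono_succ (S : NSFT) {n m : ℕ} (h : n ≤ m) : S.w n m ≤ S.w n (m + 1) := by
  classical
  let r : S.Word n (m + 1) → S.Word n m := fun y i => y ⟨i, i.2.1, Nat.le_succ_of_le i.2.2⟩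
  have hsub : S.admWords n m ⊆ r '' S.admWords n (m + 1) := by
    intro x hx
    obtain ⟨b, hb⟩ := S.row_ne_zero m (x ⟨m, h, le_refl m⟩)
    have hb1 : S.L m (x ⟨m, h, le_refl m⟩) b = 1 := (S.zero_one m _ b).resolve_left hb
    let y0 : S.Word n (m + 1) := fun i =>
      if hi : (i : ℕ) ≤ m then x ⟨i, i.2.1, hi⟩ else ⟨0, S.l_pos i⟩
    let y : S.Word n (m + 1) :=
      Function.update y0 ⟨m + 1, Nat.le_succ_of_le h, le_refl _⟩ b
    have hy : ∀ (i : ℕ) (h1 : n ≤ i) (h2 : i ≤ m),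
        y ⟨i, h1, Nat.le_succ_of_le h2⟩ = x ⟨i, h1, h2⟩ := by
      intro i h1 h2
      have hne : (⟨i, h1, Nat.le_succ_of_le h2⟩ : Set.Icc n (m + 1)) ≠
          ⟨m + 1, Nat.le_succ_of_le h, le_refl _⟩ := by
        intro e
        have := congrArg Subtype.val e
        simp only at this
        omega
      simp only [y, Function.update_of_ne hne, y0, dif_pos h2]
    refine ⟨y, ?_, ?_⟩
    · intro i h1 h2
      rcases Nat.lt_or_ge i m with h3 | h3
      · rw [hy i h1 h3.le, hy (i + 1) (by omega) (by omega)]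
        exact hx i h1 h3
      · obtain rfl : i = m := by omega
        rw [hy i h1 (le_refl _)]
        simpa only [y, Function.update_self] using hb1
    · funext i
      exact hy i i.2.1 i.2.2
  exact (Set.ncard_le_ncard hsub (Set.toFinite _)).trans (Set.ncard_image_le (Set.toFinite _))

theorem w_mono (S : NSFT) {n m m' : ℕ} (h : n ≤ m) (h' : m ≤ m') : S.w n m ≤ S.w n m' := by
  induction m', h' using Nat.le_induction with
  | base => exact le_refl _
  | succ j hj ih => exact ih.trans (S.w_mono_succ (h.trans hj))

theorem w_pos (S : NSFT) {k : ℕ} (x : S.Space k) (m : ℕ) : 0 < S.w k m := by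
  refine (Set.ncard_pos (Set.toFinite _)).2 ⟨fun i => x.seq ⟨i, i.2.1⟩, ?_⟩
  intro i hn _
  exact x.adm i hn

theorem sSup_agreeSet_mem (S : NSFT) {k : ℕ} {x y : S.Space k} (hne : x ≠ y)
    (h0 : x.seq ⟨k, le_refl k⟩ = y.seq ⟨k, le_refl k⟩) :
    BddAbove (S.agreeSet x y) ∧ sSup (S.agreeSet x y) ∈ S.agreeSet x y := by
  have hb : BddAbove (S.agreeSet x y) := by
    by_contra hb
    apply hne
    ext i : 2
    have hb' := mt (fun h => (⟨(i : ℕ), h⟩ : BddAbove (S.agreeSet x y))) hb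
    simp only [mem_upperBounds, not_forall, not_le] at hb'
    obtain ⟨r, hr, hlt⟩ := hb'
    exact hr.2 i hlt.le
  refine ⟨hb, Nat.sSup_mem ⟨k, le_refl k, ?_⟩ hb⟩
  rintro ⟨i, hi⟩ hik
  have hi' : k ≤ i := hi
  obtain rfl : i = k := le_antisymm hik hi'
  exact h0

theorem agreeSet_comm (S : NSFT) {k : ℕ} (x y : S.Space k) :
    S.agreeSet x y = S.agreeSet y x := by
  ext r
  simp only [agreeSet, Set.mem_ofPred_eq, eq_comm]

theorem spaceDist_nonneg (S : NSFT) {k : ℕ} (x y : S.Space k) : 0 ≤ S.spaceDist x y := by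
  unfold spaceDist
  split_ifs <;> positivity

theorem spaceDist_le_one (S : NSFT) {k : ℕ} (x y : S.Space k) : S.spaceDist x y ≤ 1 := by
  unfold spaceDist
  split_ifs
  · exact zero_le_one
  · exact le_refl _
  · exact inv_le_one_of_one_le₀ (by exact_mod_cast S.w_pos x _)

theorem spaceDist_comm (S : NSFT) {k : ℕ} (x y : S.Space k) :
    S.spaceDist x y = S.spaceDist y x := by
  by_cases h : x = y
  · rw [h]
  · by_cases h0 : x.seq ⟨k, le_refl k⟩ = y.seq ⟨k, le_refl k⟩
    · simp [spaceDist, h, h0, Ne.symm h, S.agreeSet_comm x y]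
    · simp [spaceDist, h, h0, Ne.symm h, Ne.symm h0]

theorem spaceDist_ultra (S : NSFT) {k : ℕ} (x y z : S.Space k) :
    S.spaceDist x z ≤ max (S.spaceDist x y) (S.spaceDist y z) := by
  by_cases hxy : x = y
  · subst hxy; exact le_max_right _ _
  by_cases hyz : y = z
  · subst hyz; exact le_max_left _ _
  by_cases hxz : x = z
  · have : S.spaceDist x z = 0 := by simp [spaceDist, hxz]
    rw [this]
    exact (S.spaceDist_nonneg x y).trans (le_max_left _ _)
  by_cases h1 : x.seq ⟨k, le_refl k⟩ = y.seq ⟨k, le_refl k⟩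
  swap
  · have : S.spaceDist x y = 1 := by simp [spaceDist, hxy, h1]
    exact (S.spaceDist_le_one x z).trans (this ▸ le_max_left _ _)
  by_cases h2 : y.seq ⟨k, le_refl k⟩ = z.seq ⟨k, le_refl k⟩
  swap
  · have : S.spaceDist y z = 1 := by simp [spaceDist, hyz, h2]
    exact (S.spaceDist_le_one x z).trans (this ▸ le_max_right _ _)
  have h3 := h1.trans h2
  obtain ⟨_, ma⟩ := S.sSup_agreeSet_mem hxy h1
  obtain ⟨_, mb⟩ := S.sSup_agreeSet_mem hyz h2
  obtain ⟨bc, _⟩ := S.sSup_agreeSet_mem hxz h3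
  have hc : min (sSup (S.agreeSet x y)) (sSup (S.agreeSet y z)) ≤ sSup (S.agreeSet x z) := by
    refine le_csSup bc ⟨le_min ma.1 mb.1, fun i hi => ?_⟩
    exact (ma.2 i (hi.trans (min_le_left _ _))).trans (mb.2 i (hi.trans (min_le_right _ _)))
  have key : ∀ a, k ≤ a → a ≤ sSup (S.agreeSet x z) →
      ((S.w k (sSup (S.agreeSet x z)) : ℕ) : ℝ)⁻¹ ≤ ((S.w k a : ℕ) : ℝ)⁻¹ := by
    intro a ha hac
    exact inv_anti₀ (by exact_mod_cast S.w_pos x a) (by exact_mod_cast S.w_mono ha hac)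
  have e1 : S.spaceDist x z = ((S.w k (sSup (S.agreeSet x z)) : ℕ) : ℝ)⁻¹ := by
    simp [spaceDist, hxz, h3]
  have e2 : S.spaceDist x y = ((S.w k (sSup (S.agreeSet x y)) : ℕ) : ℝ)⁻¹ := by
    simp [spaceDist, hxy, h1]
  have e3 : S.spaceDist y z = ((S.w k (sSup (S.agreeSet y z)) : ℕ) : ℝ)⁻¹ := by
    simp [spaceDist, hyz, h2]
  rw [e1, e2, e3]
  rcases min_le_iff.1 hc with h | h
  · exact (key _ ma.1 h).trans (le_max_left _ _)
  · exact (key _ mb.1 h).trans (le_max_right _ _)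

theorem eq_of_spaceDist_eq_zero (S : NSFT) {k : ℕ} {x y : S.Space k}
    (h : S.spaceDist x y = 0) : x = y := by
  by_contra hne
  have hw := S.w_pos x (sSup (S.agreeSet x y))
  unfold spaceDist at h
  rw [if_neg hne] at h
  split_ifs at h
  · exact one_ne_zero h
  · rw [inv_eq_zero] at h
    exact hw.ne' (by exact_mod_cast h)

instance instMetricSpaceSpace (S : NSFT) (k : ℕ) : MetricSpace (S.Space k) where
  dist := S.spaceDist
  dist_self x := by simp [spaceDist]
  dist_comm := S.spaceDist_comm
  dist_triangle x y z := (S.spaceDist_ultra x y z).trans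
    (max_le_add_of_nonneg (S.spaceDist_nonneg x y) (S.spaceDist_nonneg y z))
  eq_of_dist_eq_zero := S.eq_of_spaceDist_eq_zero

instance instMeasurableSpaceSpace (S : NSFT) (k : ℕ) : MeasurableSpace (S.Space k) := borel _

instance instBorelSpaceSpace (S : NSFT) (k : ℕ) : BorelSpace (S.Space k) := ⟨rfl⟩

/-- The cylinder set `[.x_k … x_m]` in `Σ_{(L)}^{k,+}`. -/
def cylinder (S : NSFT) {k m : ℕ} (x : S.Word k m) : Set (S.Space k) :=
  {y | ∀ i : Set.Icc k m, y.seq ⟨i, i.2.1⟩ = x i}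

/-- Strictly positive column vectors `ŵ_i` with `ŵ_i = L_i ŵ_{i+1}`. -/
def IsColumnSeq (S : NSFT) (wh : ∀ i, Fin (S.l i) → ℝ) : Prop :=
  (∀ i a, 0 < wh i a) ∧ ∀ i, wh i = (S.L i).mulVec (wh (i + 1))

/-- Strictly positive row vectors `v̂_i` with `v̂_i L_i = v̂_{i+1}`. -/
def IsRowSeq (S : NSFT) (vh : ∀ i, Fin (S.l i) → ℝ) : Prop :=
  (∀ i a, 0 < vh i a) ∧ ∀ i, Matrix.vecMul (vh i) (S.L i) = vh (i + 1)

/-- The sum norm of `ŵ_i`. -/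
def colNorm (S : NSFT) (wh : ∀ i, Fin (S.l i) → ℝ) (i : ℕ) : ℝ := ∑ a, |wh i a|

/-- `w_i = ŵ_i / ‖ŵ_i‖`. -/
def colNormalized (S : NSFT) (wh : ∀ i, Fin (S.l i) → ℝ) (i : ℕ) : Fin (S.l i) → ℝ :=
  fun a => wh i a / S.colNorm wh i

/-- `v_i = v̂_i / (v̂_i w_i)`. -/
def rowNormalized (S : NSFT) (wh vh : ∀ i, Fin (S.l i) → ℝ) (i : ℕ) : Fin (S.l i) → ℝ :=
  fun a => vh i a / (vh i ⬝ᵥ S.colNormalized wh i)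

/-- `λ_i = ‖ŵ_i‖ / ‖ŵ_{i+1}‖`. -/
def eig (S : NSFT) (wh : ∀ i, Fin (S.l i) → ℝ) (i : ℕ) : ℝ :=
  S.colNorm wh i / S.colNorm wh (i + 1)

/-- The probability vector `(π_i)_α = (v_i)_α (w_i)_α`. -/
def parryVec (S : NSFT) (wh vh : ∀ i, Fin (S.l i) → ℝ) (i : ℕ) : Fin (S.l i) → ℝ :=
  fun a => S.rowNormalized wh vh i a * S.colNormalized wh i a

/-- The stochastic matrix `P_i = (1/λ_i) W_i⁻¹ L_i W_{i+1}`, `W_i` being the diagonal matrix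
of `w_i`. -/
def parryMat (S : NSFT) (wh : ∀ i, Fin (S.l i) → ℝ) (i : ℕ) :
    Matrix (Fin (S.l i)) (Fin (S.l (i + 1))) ℝ :=
  (1 / S.eig wh i) • ((Matrix.diagonal (S.colNormalized wh i))⁻¹ * S.L i *
    Matrix.diagonal (S.colNormalized wh (i + 1)))

/-- `μ_∞` is the Parry measure sequence of `ŵ_∞` and `v̂_∞`: the Borel measures on the spaces
`Σ_{(L)}^{k,+}` with
`μ_k([.x_k … x_m]) = (π_k)_{x_k} (P_k)_{x_k x_{k+1}} ⋯ (P_{m-1})_{x_{m-1} x_m}`. -/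
def IsParry (S : NSFT) (wh vh : ∀ i, Fin (S.l i) → ℝ) (μ : ∀ k, Measure (S.Space k)) : Prop :=
  S.IsColumnSeq wh ∧ S.IsRowSeq vh ∧
  ∀ (k m : ℕ) (hkm : k ≤ m) (x : S.Word k m),
    μ k (S.cylinder x) = ENNReal.ofReal
      (S.parryVec wh vh k (x ⟨k, le_refl k, hkm⟩) *
        ∏ i : Set.Ico k m, S.parryMat wh i (x ⟨i, i.2.1, i.2.2.le⟩)
          (x ⟨i + 1, Nat.le_succ_of_le i.2.1, i.2.2⟩))

/-- `m_n(ε) = min {m ≥ 0 : w(n, n+m) > 1/ε}`, and `0` if there is no such `m`. -/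
def mIdx (S : NSFT) (ε : ℝ) (n : ℕ) : ℕ := sInf {m : ℕ | 1 / ε < (S.w n (n + m) : ℝ)}

/-- `n_k(ε) = k + m_k(ε)`. -/
def nIdx (S : NSFT) (ε : ℝ) (k : ℕ) : ℕ := k + S.mIdx ε k

/-- `ñ_k(ε) = max_{0 ≤ i ≤ k} (i + m_i(ε))`. -/
def nTilde (S : NSFT) (ε : ℝ) (k : ℕ) : ℕ := (Finset.range (k + 1)).sup fun i => i + S.mIdx ε i

/-- The column sum `∑_α L^{(0,k)}_{αγ}`. -/
def colSum (S : NSFT) (k : ℕ) (γ : Fin (S.l k)) : ℝ := ∑ α, S.matProd (Nat.zero_le k) α γ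

/-- `γ ∈ 𝒜_k` maximizes the column sum of `L^{(0,k)}`. -/
def Maximizes (S : NSFT) (k : ℕ) (γ : Fin (S.l k)) : Prop := ∀ β, S.colSum k β ≤ S.colSum k γ

end

end NSFT

/-! Both entropies are compared with the words `(x_0, …, x_N)`, `N = ñ_k(ε)`. Two sequences that
agree up to `N` have iterates at times `i ≤ k` within `ε` of each other; conversely, the windows
`[i, n_i(ε)]`, `i ≤ k`, cover `[0, N]`, and each window carries a number of words bounded in terms
of `ε` only, so cylinders over it are uniformly separated. Hence the metric entropy is the limit as
`ε → 0` of the growth rate of the Shannon entropy `H` of these words (`IsParry.joinEntropy_le`,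
`IsParry.shannon_le_joinEntropy`), and the topological entropy is the supremum over `ε` of the
growth rate of `log w(0, N)` (`minSubcover_joinCover_le`, `IsParry.w_le_minSubcover`).

For (i), the Parry measure of a cylinder telescopes to `v̂_0(x_0) ŵ_n(x_n) / c` with one constant
`c`, while `π_n = v̂_n ŵ_n / c`. So `-log μ_0` of a cylinder is `log v̂_n(x_n)` up to terms of
bounded mean, and `v̂_n = v̂_0 L^{(0,n)}` is comparable to the column sums. Thus `H` is the mean
logarithm of the column sums up to a bounded error (`IsParry.exists_abs_shannon_sub_le`).

For (ii), `H ≤ log w(0, N)` gives one inequality. For the other, the largest column sum at time `k`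
is comparable to `w(0, k)`, and under the hypothesis it is inherited at time `n_k(ε)` by letters of
total mass at least `1 - δ`; so the mean logarithm there is at least `(1 - δ) log w(0, k)` up to a
constant (`IsParry.exists_log_w_le`). The delay is absorbed by a smaller `ε`, and `log w(0, ñ_k(ε))`
grows at most linearly in `k`, so the loss vanishes with `δ`.

If the numbers of words are bounded, `Σ^0` is finite and everything is zero. -/

namespace NDS

noncomputable section

/-! ### Shannon entropy of finite-valued random variables. -/

/-- The Shannon entropy of the finite-valued random variable `X`. -/
def shannon {Ω A : Type*} [MeasurableSpace Ω] [Fintype A] (μ : Measure Ω) (X : Ω → A) : ℝ :=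
  ∑ a, Real.negMulLog (μ.real (X ⁻¹' {a}))

theorem negMulLog_sum_le {ι : Type*} (s : Finset ι) (p : ι → ℝ) (hp : ∀ i, 0 ≤ p i) :
    Real.negMulLog (∑ i ∈ s, p i) ≤ ∑ i ∈ s, Real.negMulLog (p i) := by
  rw [Real.negMulLog, neg_mul, Finset.sum_mul, ← Finset.sum_neg_distrib]
  refine Finset.sum_le_sum fun i hi => ?_
  rw [Real.negMulLog, neg_mul]
  rcases (hp i).eq_or_lt with h | h
  · simp [← h]
  · have := Real.log_le_log h (Finset.single_le_sum (f := p) (fun j _ => hp j) hi)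
    have := mul_le_mul_of_nonneg_left this (hp i)
    linarith

/-- Gibbs' inequality. -/
theorem sum_negMulLog_le {ι : Type*} (s : Finset ι) (p q : ι → ℝ) (hp : ∀ i ∈ s, 0 ≤ p i)
    (hq : ∀ i ∈ s, 0 ≤ q i) (hpq : ∀ i ∈ s, q i = 0 → p i = 0)
    (hsum : ∑ i ∈ s, q i ≤ ∑ i ∈ s, p i) :
    ∑ i ∈ s, Real.negMulLog (p i) ≤ ∑ i ∈ s, p i * -Real.log (q i) := by
  -- This is `log t ≤ t - 1` at `t = q i / p i`; the corrections `q i - p i` have nonpositive sum.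
  have key : ∀ i ∈ s, Real.negMulLog (p i) ≤ p i * -Real.log (q i) + (q i - p i) := by
    intro i hi
    rcases (hp i hi).eq_or_lt with h | h
    · simpa [← h] using hq i hi
    · have hq' : 0 < q i := (hq i hi).lt_of_ne fun e => h.ne' (hpq i hi e.symm)
      have h1 := Real.log_le_sub_one_of_pos (div_pos hq' h)
      rw [Real.log_div hq'.ne' h.ne'] at h1
      have h2 := mul_le_mul_of_nonneg_left h1 h.le
      have h3 : p i * (q i / p i - 1) = q i - p i := by field_simp
      rw [h3] at h2
      rw [Real.negMulLog]
      linarith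
  have := Finset.sum_le_sum key
  rw [Finset.sum_add_distrib, Finset.sum_sub_distrib] at this
  linarith

section

variable {Ω A B : Type*} [MeasurableSpace Ω] [Fintype A] [Fintype B] {μ : Measure Ω}
  [IsProbabilityMeasure μ] {X : Ω → A}

theorem sum_real_fiber (hX : ∀ a, MeasurableSet (X ⁻¹' {a})) (S : A → Prop) [DecidablePred S] :
    ∑ a with S a, μ.real (X ⁻¹' {a}) = μ.real {ω | S (X ω)} := by
  rw [sum_measureReal_preimage_singleton _ fun a _ => hX a]
  congr 1
  ext ω
  simp

theorem sum_real_fiber_univ (hX : ∀ a, MeasurableSet (X ⁻¹' {a})) :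
    ∑ a, μ.real (X ⁻¹' {a}) = 1 := by
  have := sum_real_fiber (μ := μ) hX fun _ => True
  simpa using this

theorem sum_real_fiber_mul [DecidableEq B] (hX : ∀ a, MeasurableSet (X ⁻¹' {a})) (f : A → B)
    (φ : B → ℝ) :
    ∑ a, μ.real (X ⁻¹' {a}) * φ (f a) = ∑ b, μ.real {ω | f (X ω) = b} * φ b := by
  rw [← Finset.sum_fiberwise (s := Finset.univ) (g := f)]
  refine Finset.sum_congr rfl fun b _ => ?_
  rw [← sum_real_fiber hX (fun a => f a = b), Finset.sum_mul]
  refine Finset.sum_congr rfl fun a ha => ?_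
  rw [(Finset.mem_filter.1 ha).2]

theorem shannon_comp_le (hX : ∀ a, MeasurableSet (X ⁻¹' {a})) (f : A → B) :
    shannon μ (fun ω => f (X ω)) ≤ shannon μ X := by
  classical
  unfold shannon
  rw [← Finset.sum_fiberwise (s := Finset.univ) (g := f)]
  refine Finset.sum_le_sum fun b _ => ?_
  have : (fun ω => f (X ω)) ⁻¹' {b} = {ω | f (X ω) = b} := rfl
  rw [this, ← sum_real_fiber hX (fun a => f a = b)]
  exact negMulLog_sum_le _ _ fun _ => measureReal_nonneg

theorem shannon_le_of_factor [Nonempty B] {Y : Ω → B} (hX : ∀ a, MeasurableSet (X ⁻¹' {a}))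
    (h : ∀ ω ω', X ω = X ω' → Y ω = Y ω') : shannon μ Y ≤ shannon μ X := by
  classical
  -- Values that `X` never takes get an arbitrary label, which is why `B` must be nonempty.
  let f : A → B := fun a => if h : ∃ ω, X ω = a then Y h.choose else Classical.arbitrary B
  have hf : Y = fun ω => f (X ω) := by
    funext ω
    have he : ∃ ω', X ω' = X ω := ⟨ω, rfl⟩
    simp only [f, dif_pos he]
    exact h _ _ he.choose_spec.symm
  rw [hf]
  exact shannon_comp_le hX f

theorem shannon_nonneg : 0 ≤ shannon μ X :=
  Finset.sum_nonneg fun _ _ => Real.negMulLog_nonneg measureReal_nonneg measureReal_le_one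

/-- A variable concentrated on `m` values has entropy at most `log m`. -/
theorem shannon_le_log_card (hX : ∀ a, MeasurableSet (X ⁻¹' {a})) (T : Finset A)
    (hT : ∀ ω, X ω ∈ T) : shannon μ X ≤ Real.log T.card := by
  classical
  have hne : T.Nonempty := by
    obtain ⟨ω⟩ : Nonempty Ω := nonempty_of_isProbabilityMeasure μ
    exact ⟨_, hT ω⟩
  have hc : (0 : ℝ) < T.card := by exact_mod_cast hne.card_pos
  have hp : ∀ a ∉ T, μ.real (X ⁻¹' {a}) = 0 := by
    intro a ha
    have : X ⁻¹' {a} = ∅ := by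
      ext ω
      simp only [Set.mem_preimage, Set.mem_singleton_iff, Set.mem_empty_iff_false, iff_false]
      rintro rfl
      exact ha (hT ω)
    simp [this]
  have h1 : shannon μ X = ∑ a ∈ T, Real.negMulLog (μ.real (X ⁻¹' {a})) := by
    unfold shannon
    refine (Finset.sum_subset (Finset.subset_univ _) fun a _ ha => ?_).symm
    simp [hp a ha]
  have h2 : ∑ a ∈ T, μ.real (X ⁻¹' {a}) = 1 := by
    rw [← sum_real_fiber_univ (μ := μ) hX]
    exact Finset.sum_subset (Finset.subset_univ _) fun a _ ha => hp a ha
  rw [h1]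
  refine (sum_negMulLog_le T _ (fun _ => (T.card : ℝ)⁻¹) (fun _ _ => measureReal_nonneg)
    (fun _ _ => by positivity) (fun _ _ h => absurd h (by positivity)) ?_).trans ?_
  · rw [h2]
    simp [hc.ne']
  · rw [← Finset.sum_mul, h2]
    simp

/-- If each component of `F` is with high probability a function of `X`, the entropy of `F`
exceeds that of `X` by little. -/
theorem shannon_le_add_of_approx {n C : ℕ} {c : Fin n → ℕ} (hc : ∀ i, c i ≤ C)
    {F : Ω → ∀ i, Fin (c i)} (hX : ∀ a, MeasurableSet (X ⁻¹' {a}))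
    (hF : ∀ s, MeasurableSet (F ⁻¹' {s})) (g : ∀ i, A → Fin (c i)) {e τ : ℝ} (he : 0 < e)
    (he1 : e < 1) (hC : 0 < C) (hg : ∀ i, μ.real {ω | F ω i ≠ g i (X ω)} ≤ τ) :
    shannon μ F ≤ shannon μ X + n * (-Real.log (1 - e) + τ * Real.log (C / e)) := by
  classical
  have hCr : (0 : ℝ) < C := by exact_mod_cast hC
  have hC1 : (1 : ℝ) ≤ C := by exact_mod_cast hC
  have hlog : 0 ≤ Real.log (C / e) := Real.log_nonneg ((one_le_div he).2 (he1.le.trans hC1))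
  let Z : Ω → (∀ i, Fin (c i)) × A := fun ω => (F ω, X ω)
  have hZ : ∀ z, MeasurableSet (Z ⁻¹' {z}) := by
    rintro ⟨s, a⟩
    have : Z ⁻¹' {(s, a)} = F ⁻¹' {s} ∩ X ⁻¹' {a} := by
      ext ω
      simp [Z]
    rw [this]
    exact (hF s).inter (hX a)
  have h0 : shannon μ F ≤ shannon μ Z := shannon_comp_le (f := Prod.fst) hZ
  -- A model law for Gibbs' inequality, as in Fano's inequality: `X` keeps its true law and, given
  -- `X`, the coordinates are independent, with weight `1 - e` on the predicted value and `e / C` on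
  -- every other one. Its total mass is at most `1`.
  let r : ∀ i, Fin (c i) → Fin (c i) → ℝ := fun i a b => if b = a then 1 - e else e / C
  have hr : ∀ i a b, 0 < r i a b := by
    intro i a b
    simp only [r]
    split_ifs
    · linarith
    · positivity
  have hrsum : ∀ i a, ∑ b, r i a b ≤ 1 := by
    intro i a
    have h1 : ∀ b, r i a b ≤ (if b = a then 1 - e else 0) + e / C := by
      intro b
      simp only [r]
      have : 0 < e / C := by positivity
      split_ifs <;> linarith
    refine (Finset.sum_le_sum fun b _ => h1 b).trans ?_
    rw [Finset.sum_add_distrib, Finset.sum_ite_eq']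
    simp only [Finset.mem_univ, if_true, Finset.sum_const, Finset.card_univ, Fintype.card_fin,
      nsmul_eq_mul]
    have h2 : (c i : ℝ) ≤ C := by exact_mod_cast hc i
    have h3 : (c i : ℝ) * (e / C) ≤ C * (e / C) :=
      mul_le_mul_of_nonneg_right h2 (by positivity)
    have h4 : (C : ℝ) * (e / C) = e := by field_simp
    linarith
  let q : (∀ i, Fin (c i)) × A → ℝ := fun z =>
    μ.real (X ⁻¹' {z.2}) * ∏ i, r i (g i z.2) (z.1 i)
  have hprod : ∀ z : (∀ i, Fin (c i)) × A, 0 < ∏ i, r i (g i z.2) (z.1 i) := fun z =>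
    Finset.prod_pos fun i _ => hr _ _ _
  have hle : ∀ z, μ.real (Z ⁻¹' {z}) ≤ μ.real (X ⁻¹' {z.2}) := by
    intro z
    refine measureReal_mono ?_
    rintro ω rfl
    rfl
  have hG := sum_negMulLog_le (Finset.univ) (fun z => μ.real (Z ⁻¹' {z})) q
    (fun _ _ => measureReal_nonneg) (fun z _ => mul_nonneg measureReal_nonneg (hprod z).le)
    (fun z _ hz => by
      rcases mul_eq_zero.1 hz with h | h
      · exact le_antisymm ((hle z).trans h.le) measureReal_nonneg
      · exact absurd h (hprod z).ne')
    (by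
      rw [sum_real_fiber_univ hZ, Fintype.sum_prod_type, Finset.sum_comm,
        ← sum_real_fiber_univ (μ := μ) hX]
      refine Finset.sum_le_sum fun a _ => ?_
      simp only [q]
      rw [← Finset.mul_sum]
      refine mul_le_of_le_one_right measureReal_nonneg ?_
      have := Finset.prod_univ_sum (t := fun i => (Finset.univ : Finset (Fin (c i))))
        (f := fun i b => r i (g i a) b)
      rw [Fintype.piFinset_univ] at this
      rw [← this]
      exact Finset.prod_le_one (fun i _ => Finset.sum_nonneg fun b _ => (hr _ _ _).le)
        fun i _ => hrsum i _)
  refine h0.trans (hG.trans ?_)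
  -- Under the model each coordinate costs at most `-log (1 - e)`, and at most `log (C / e)` more
  -- when the prediction fails.
  have hterm : ∀ z, μ.real (Z ⁻¹' {z}) * -Real.log (q z) ≤
      μ.real (Z ⁻¹' {z}) * -Real.log (μ.real (X ⁻¹' {z.2})) +
      ∑ i, (μ.real (Z ⁻¹' {z}) * -Real.log (1 - e) +
        μ.real (Z ⁻¹' {z}) * if z.1 i ≠ g i z.2 then Real.log (C / e) else 0) := by
    intro z
    rcases (measureReal_nonneg (μ := μ) (s := Z ⁻¹' {z})).eq_or_lt with h | h
    · simp [← h]
    have hx : 0 < μ.real (X ⁻¹' {z.2}) := h.trans_le (hle z)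
    simp only [q]
    rw [Real.log_mul hx.ne' (hprod z).ne', Real.log_prod fun i _ => (hr _ _ _).ne', neg_add,
      mul_add, ← Finset.sum_neg_distrib, Finset.mul_sum]
    refine add_le_add le_rfl (Finset.sum_le_sum fun i _ => ?_)
    rw [← mul_add]
    refine mul_le_mul_of_nonneg_left ?_ h.le
    have hl1 : Real.log (1 - e) ≤ 0 := Real.log_nonpos (by linarith) (by linarith)
    by_cases hi : z.1 i = g i z.2
    · simp [r, hi]
    · simp only [r, hi, if_false, ne_eq, not_false_eq_true, if_true]
      rw [Real.log_div he.ne' hCr.ne', Real.log_div hCr.ne' he.ne']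
      linarith
  refine (Finset.sum_le_sum fun z _ => hterm z).trans ?_
  rw [Finset.sum_add_distrib, Finset.sum_comm]
  refine add_le_add (le_of_eq ?_) ?_
  · rw [sum_real_fiber_mul hZ Prod.snd fun a => -Real.log (μ.real (X ⁻¹' {a}))]
    refine Finset.sum_congr rfl fun a _ => ?_
    rw [Real.negMulLog]
    have : {ω | (Z ω).2 = a} = X ⁻¹' {a} := rfl
    rw [this]
    ring
  · have hi : ∀ i : Fin n, ∑ z, (μ.real (Z ⁻¹' {z}) * -Real.log (1 - e) +
        μ.real (Z ⁻¹' {z}) * if z.1 i ≠ g i z.2 then Real.log (C / e) else 0) ≤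
        -Real.log (1 - e) + τ * Real.log (C / e) := by
      intro i
      rw [Finset.sum_add_distrib, ← Finset.sum_mul, sum_real_fiber_univ hZ, one_mul]
      simp only [mul_ite, mul_zero]
      rw [← Finset.sum_filter, ← Finset.sum_mul,
        sum_real_fiber hZ (fun z => z.1 i ≠ g i z.2)]
      exact add_le_add le_rfl (mul_le_mul_of_nonneg_right (hg i) hlog)
    refine (Finset.sum_le_sum fun i _ => hi i).trans ?_
    rw [Finset.sum_const, Finset.card_univ, Fintype.card_fin, nsmul_eq_mul]

end

end

end NDS

/-! ### Cylinders, the metric, compactness and the Borel sets of `Σ^k`. -/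

namespace NSFT

noncomputable section

variable (S : NSFT)

/-- The word `(y_k, …, y_m)` of a sequence `y`. -/
def pref {k : ℕ} (m : ℕ) (y : S.Space k) : S.Word k m := fun i => y.seq ⟨i, i.2.1⟩

theorem cylinder_eq_preimage {k m : ℕ} (x : S.Word k m) : S.cylinder x = S.pref m ⁻¹' {x} := by
  ext y
  exact ⟨fun h => funext h, fun h i => congrFun h i⟩

theorem pref_mem_admWords {k : ℕ} (m : ℕ) (y : S.Space k) : S.pref m y ∈ S.admWords k m :=
  fun i hn _ => y.adm i hn

theorem pref_eq_iff {k m : ℕ} {y z : S.Space k} :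
    S.pref m y = S.pref m z ↔ ∀ i (hi : k ≤ i), i ≤ m → y.seq ⟨i, hi⟩ = z.seq ⟨i, hi⟩ :=
  ⟨fun h i hi him => congrFun h ⟨i, hi, him⟩, fun h => funext fun i => h i i.2.1 i.2.2⟩

theorem pref_eq_of_le {k m m' : ℕ} (h : m ≤ m') {y z : S.Space k}
    (hyz : S.pref m' y = S.pref m' z) : S.pref m y = S.pref m z := by
  rw [pref_eq_iff] at hyz ⊢
  exact fun i hi him => hyz i hi (him.trans h)

theorem iter_shift_seq (y : S.Space 0) : ∀ (n j : ℕ) (hj : n ≤ j),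
    (NDS.iter S.shift n y).seq ⟨j, hj⟩ = y.seq ⟨j, Nat.zero_le j⟩
  | 0, _, _ => rfl
  | n + 1, j, hj => iter_shift_seq y n j (Nat.le_of_succ_le hj)

theorem pref_iter_eq {m : ℕ} {y z : S.Space 0} (h : S.pref m y = S.pref m z) (n : ℕ) :
    S.pref m (NDS.iter S.shift n y) = S.pref m (NDS.iter S.shift n z) := by
  rw [pref_eq_iff] at h ⊢
  intro i hi him
  rw [iter_shift_seq, iter_shift_seq]
  exact h i _ him

/-- Sequences that first differ at or before position `m` are at distance `1` or `w(k,r)⁻¹` with `r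
< m`, and `w(k, ·)` is nondecreasing. -/
theorem pref_eq_of_dist_lt {k m : ℕ} {y z : S.Space k} (h : dist y z < (S.w k m : ℝ)⁻¹) :
    S.pref m y = S.pref m z := by
  by_cases hyz : y = z
  · rw [hyz]
  have h' : S.spaceDist y z < (S.w k m : ℝ)⁻¹ := h
  have hw : (1 : ℝ) ≤ S.w k m := by exact_mod_cast S.w_pos y m
  unfold spaceDist at h'
  rw [if_neg hyz] at h'
  split_ifs at h' with h0
  · exact absurd h' (not_lt.2 (inv_le_one_of_one_le₀ hw))
  · obtain ⟨_, hm⟩ := S.sSup_agreeSet_mem hyz (not_not.1 h0)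
    rw [pref_eq_iff]
    intro i hi him
    refine hm.2 ⟨i, hi⟩ (him.trans ?_)
    by_contra hlt
    have := S.w_mono hm.1 (not_le.1 hlt).le
    have h2 : (S.w k m : ℝ)⁻¹ ≤ (S.w k (sSup (S.agreeSet y z)) : ℝ)⁻¹ :=
      inv_anti₀ (by exact_mod_cast S.w_pos y _) (by exact_mod_cast this)
    exact absurd h' (not_lt.2 h2)

theorem dist_le_of_pref_eq {k m : ℕ} (hkm : k ≤ m) {y z : S.Space k}
    (h : S.pref m y = S.pref m z) : dist y z ≤ (S.w k m : ℝ)⁻¹ := by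
  change S.spaceDist y z ≤ _
  by_cases hyz : y = z
  · rw [hyz]
    simp [spaceDist]
  have h' := S.pref_eq_iff.1 h
  have h0 := h' k le_rfl hkm
  obtain ⟨hb, hm⟩ := S.sSup_agreeSet_mem hyz h0
  have hs : m ≤ sSup (S.agreeSet y z) := le_csSup hb ⟨hkm, fun i hi => h' i i.2 hi⟩
  unfold spaceDist
  rw [if_neg hyz, if_neg (not_not.2 h0)]
  exact inv_anti₀ (by exact_mod_cast S.w_pos y _) (by exact_mod_cast S.w_mono hkm hs)

theorem dist_lt_of_pref_eq {k m : ℕ} (hkm : k ≤ m) {ε : ℝ} (hε : 0 < ε)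
    (hw : 1 / ε < (S.w k m : ℝ)) {y z : S.Space k} (h : S.pref m y = S.pref m z) :
    dist y z < ε := by
  refine (S.dist_le_of_pref_eq hkm h).trans_lt ?_
  rw [inv_lt_comm₀ ((one_div_pos.2 hε).trans hw) hε]
  simpa using hw

theorem isOpen_pref_preimage {k : ℕ} (m : ℕ) (T : Set (S.Word k m)) :
    IsOpen (S.pref m ⁻¹' T : Set (S.Space k)) := by
  rw [Metric.isOpen_iff]
  intro y hy
  refine ⟨(S.w k m : ℝ)⁻¹, inv_pos.2 (by exact_mod_cast S.w_pos y m), fun z hz => ?_⟩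
  have : S.pref m z = S.pref m y := S.pref_eq_of_dist_lt hz
  change S.pref m z ∈ T
  rw [this]
  exact hy

theorem isClosed_pref_preimage {k : ℕ} (m : ℕ) (T : Set (S.Word k m)) :
    IsClosed (S.pref m ⁻¹' T : Set (S.Space k)) :=
  ⟨S.isOpen_pref_preimage m Tᶜ⟩

theorem measurableSet_pref_preimage {k : ℕ} (m : ℕ) (T : Set (S.Word k m)) :
    MeasurableSet (S.pref m ⁻¹' T : Set (S.Space k)) :=
  (S.isOpen_pref_preimage m T).measurableSet

theorem exists_pref_ne {k : ℕ} {y z : S.Space k} (h : y ≠ z) :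
    ∃ m, k ≤ m ∧ S.pref m y ≠ S.pref m z := by
  by_contra! hc
  apply h
  ext i : 2
  exact S.pref_eq_iff.1 (hc i i.2) i i.2 le_rfl

theorem exists_pref_injOn {k : ℕ} (T : Finset (S.Space k)) :
    ∃ m, k ≤ m ∧ Set.InjOn (S.pref m) (T : Set (S.Space k)) := by
  classical
  choose! f hf using fun (p : S.Space k × S.Space k) (h : p.1 ≠ p.2) => S.exists_pref_ne h
  refine ⟨max k ((T ×ˢ T).sup f), le_max_left _ _, fun y hy z hz hyz => ?_⟩
  by_contra hne
  refine (hf (y, z) hne).2 (S.pref_eq_of_le ((Finset.le_sup (f := f) ?_).trans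
    (le_max_right _ _)) hyz)
  exact Finset.mem_product.2 ⟨hy, hz⟩

/-- Any `B + 1` distinct points would be told apart by their words up to some common position. -/
theorem finite_space_of_w_le {k B : ℕ} (h : ∀ m, S.w k m ≤ B) : Finite (S.Space k) := by
  by_contra hinf
  rw [not_finite_iff_infinite] at hinf
  obtain ⟨T, hT⟩ := Infinite.exists_subset_card_eq (S.Space k) (B + 1)
  obtain ⟨m, _, hm⟩ := S.exists_pref_injOn T
  have h1 : (S.pref m '' (T : Set (S.Space k))).ncard = B + 1 := by
    rw [hm.ncard_image, Set.ncard_coe_finset, hT]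
  have h2 : (S.pref m '' (T : Set (S.Space k))).ncard ≤ S.w k m := by
    refine Set.ncard_le_ncard ?_ (Set.toFinite _)
    rintro _ ⟨y, _, rfl⟩
    exact S.pref_mem_admWords m y
  have := h m
  omega

/-- Cylinders form a neighbourhood base. If `w(k, ·)` is unbounded their diameters tend to `0`; if
it is bounded the space is finite and long cylinders are single points. -/
theorem exists_dist_lt_of_pref_eq {k : ℕ} (y : S.Space k) {ε : ℝ} (hε : 0 < ε) :
    ∃ m, k ≤ m ∧ ∀ z, S.pref m z = S.pref m y → dist z y < ε := by
  by_cases hb : ∃ B, ∀ m, S.w k m ≤ B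
  · obtain ⟨B, hB⟩ := hb
    have := S.finite_space_of_w_le hB
    have := Fintype.ofFinite (S.Space k)
    obtain ⟨m, hkm, hm⟩ := S.exists_pref_injOn (k := k) Finset.univ
    refine ⟨m, hkm, fun z hz => ?_⟩
    rw [hm (Finset.mem_coe.2 (Finset.mem_univ z)) (Finset.mem_coe.2 (Finset.mem_univ y)) hz,
      dist_self]
    exact hε
  · push Not at hb
    obtain ⟨m, hm⟩ := hb ⌈1 / ε⌉₊
    have h1 : 1 / ε < (S.w k m : ℝ) := (Nat.le_ceil _).trans_lt (by exact_mod_cast hm)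
    refine ⟨max k m, le_max_left _ _, fun z hz =>
      S.dist_lt_of_pref_eq (le_max_left _ _) hε ?_ hz⟩
    rcases le_total k m with h | h
    · rwa [max_eq_right h]
    · refine h1.trans_le ?_
      rw [max_eq_left h]
      rcases h.eq_or_lt with rfl | h
      · exact le_rfl
      -- For `m < k` a word has no letters, so there is only one.
      · exact_mod_cast Set.ncard_le_ncard_of_injOn (fun _ => S.pref k y)
          (fun _ _ => S.pref_mem_admWords k y) (fun a _ b _ _ => funext fun i : Set.Icc k m =>
            absurd (i.2.1.trans i.2.2) (not_le.2 h)) (Set.toFinite _)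

/-- `Σ^k` is the continuous image of a closed subset of a product of finite discrete spaces. -/
instance instCompactSpaceSpace (k : ℕ) : CompactSpace (S.Space k) := by
  let T : Set (∀ i : Set.Ici k, Fin (S.l i)) :=
    {f | ∀ (i : ℕ) (hi : k ≤ i), S.L i (f ⟨i, hi⟩) (f ⟨i + 1, Nat.le_succ_of_le hi⟩) = 1}
  have hT : IsClosed T := by
    have : T = ⋂ (i : ℕ) (hi : k ≤ i),
        {f | S.L i (f ⟨i, hi⟩) (f ⟨i + 1, Nat.le_succ_of_le hi⟩) = 1} := by
      ext f
      simp [T]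
    rw [this]
    refine isClosed_iInter fun i => isClosed_iInter fun hi => ?_
    have hc : Continuous fun f : ∀ i : Set.Ici k, Fin (S.l i) =>
        (f ⟨i, hi⟩, f ⟨i + 1, Nat.le_succ_of_le hi⟩) :=
      (continuous_apply _).prodMk (continuous_apply _)
    exact (isClosed_discrete {p : Fin (S.l i) × Fin (S.l (i + 1)) | S.L i p.1 p.2 = 1}).preimage hc
  have : CompactSpace T := isCompact_iff_compactSpace.1 hT.isCompact
  let e : T → S.Space k := fun f => ⟨f.1, f.2⟩
  have he : Continuous e := by
    rw [continuous_iff_continuousAt]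
    intro f
    rw [ContinuousAt, Metric.tendsto_nhds]
    intro ε hε
    obtain ⟨m, _, hm⟩ := S.exists_dist_lt_of_pref_eq (e f) hε
    have h1 : ∀ i : Set.Icc k m, ∀ᶠ g : T in 𝓝 f, g.1 ⟨i, i.2.1⟩ = f.1 ⟨i, i.2.1⟩ := by
      intro i
      have hc : Continuous fun g : T => g.1 ⟨i, i.2.1⟩ :=
        (continuous_apply _).comp continuous_subtype_val
      exact (hc.tendsto f).eventually (IsOpen.mem_nhds (isOpen_discrete {f.1 ⟨i, i.2.1⟩}) rfl)
    filter_upwards [eventually_all.2 h1] with g hg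
    exact hm _ (funext hg)
  have hs : Function.Surjective e := fun y => ⟨⟨y.seq, y.adm⟩, rfl⟩
  exact hs.compactSpace he

theorem borel_eq_generateFrom_pref (k : ℕ) :
    borel (S.Space k) = MeasurableSpace.generateFrom
      {A | ∃ m, k ≤ m ∧ ∃ x : S.Word k m, A = S.pref m ⁻¹' {x}} := by
  refine TopologicalSpace.IsTopologicalBasis.borel_eq_generateFrom ?_
  · refine TopologicalSpace.isTopologicalBasis_of_isOpen_of_nhds ?_ ?_
    · rintro _ ⟨m, _, x, rfl⟩
      exact S.isOpen_pref_preimage m _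
    · intro y U hy hU
      obtain ⟨ε, hε, hb⟩ := Metric.isOpen_iff.1 hU y hy
      obtain ⟨m, hkm, hm⟩ := S.exists_dist_lt_of_pref_eq y hε
      exact ⟨_, ⟨m, hkm, S.pref m y, rfl⟩, rfl, fun z hz => hb (hm z hz)⟩

/-! ### Counting words, and how the indices `n_k(ε)` and `ñ_k(ε)` depend on `ε`. -/

/-- The largest alphabet size. -/
def lMax : ℕ := sSup (Set.range S.l)

theorem l_le_lMax (i : ℕ) : S.l i ≤ S.lMax := le_csSup S.l_bdd ⟨i, rfl⟩

theorem lMax_pos : 0 < S.lMax := (S.l_pos 0).trans_le (S.l_le_lMax 0)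

theorem w_self_le (k : ℕ) : S.w k k ≤ S.lMax := by
  refine le_trans ?_ (S.l_le_lMax k)
  have := Set.ncard_le_ncard_of_injOn (s := S.admWords k k) (t := (Set.univ : Set (Fin (S.l k))))
    (fun x => x ⟨k, le_rfl, le_rfl⟩) (fun _ _ => Set.mem_univ _) (fun x _ y _ h => by
      funext ⟨i, hi⟩
      obtain rfl : i = k := le_antisymm hi.2 hi.1
      exact h) (Set.toFinite _)
  simpa [w, Set.ncard_univ] using this

/-- A word is determined by its restrictions to two windows that cover it; `b' ≤ b + 1` allows
windows that overlap as well as adjacent ones. -/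
theorem w_le_mul {a b b' c : ℕ} (h1 : a ≤ b') (h2 : b' ≤ b + 1) (h3 : b ≤ c) :
    S.w a c ≤ S.w a b * S.w b' c := by
  unfold w
  rw [← Set.ncard_prod]
  refine Set.ncard_le_ncard_of_injOn
    (fun x : S.Word a c => ((fun i => x ⟨i, i.2.1, i.2.2.trans h3⟩ : S.Word a b),
      (fun i => x ⟨i, h1.trans i.2.1, i.2.2⟩ : S.Word b' c))) ?_ ?_ (Set.toFinite _)
  · intro x hx
    exact ⟨fun i hn hm => hx i hn (hm.trans h3), fun i hn hm => hx i (h1.trans hn) hm⟩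
  · intro x _ y _ h
    rw [Prod.mk.injEq] at h
    funext ⟨i, hi⟩
    rcases Nat.lt_or_ge b i with hb | hb
    · exact congrFun h.2 ⟨i, by omega, hi.2⟩
    · exact congrFun h.1 ⟨i, hi.1, hb⟩

theorem le_nIdx_self (ε : ℝ) (k : ℕ) : k ≤ S.nIdx ε k := Nat.le_add_right _ _

theorem nIdx_le_nTilde (ε : ℝ) {i k : ℕ} (h : i ≤ k) : S.nIdx ε i ≤ S.nTilde ε k :=
  Finset.le_sup (f := fun i => i + S.mIdx ε i) (Finset.mem_range.2 (Nat.lt_succ_of_le h))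

theorem le_nTilde (ε : ℝ) (k : ℕ) : k ≤ S.nTilde ε k :=
  (S.le_nIdx_self ε k).trans (S.nIdx_le_nTilde ε le_rfl)

theorem exists_nTilde_eq (ε : ℝ) (k : ℕ) : ∃ i ≤ k, S.nTilde ε k = S.nIdx ε i := by
  obtain ⟨i, hi, h⟩ := Finset.exists_mem_eq_sup (Finset.range (k + 1)) ⟨0, by simp⟩
    fun i => i + S.mIdx ε i
  exact ⟨i, Nat.lt_succ_iff.1 (Finset.mem_range.1 hi), h⟩

/-- By minimality of `m_k(ε)` there are at most `1/ε` words one letter shorter, and the last letter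
contributes a factor at most `lMax`. The summand `1` covers `m_k(ε) = 0`. -/
theorem w_nIdx_le {ε : ℝ} (hε : 0 < ε) (k : ℕ) :
    (S.w k (S.nIdx ε k) : ℝ) ≤ S.lMax * (1 + 1 / ε) := by
  have hl : (0 : ℝ) ≤ S.lMax := Nat.cast_nonneg _
  have he : 0 < 1 / ε := one_div_pos.2 hε
  rcases h : S.mIdx ε k with _ | m
  · have h1 : (S.w k (S.nIdx ε k) : ℝ) ≤ S.lMax := by
      rw [nIdx, h]
      exact_mod_cast S.w_self_le k
    nlinarith
  · have h1 : (S.w k (k + m) : ℝ) ≤ 1 / ε := by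
      have hn : m ∉ {m : ℕ | 1 / ε < (S.w k (k + m) : ℝ)} :=
        Nat.notMem_of_lt_sInf (show m < S.mIdx ε k by omega)
      simpa using hn
    have h2 : S.w k (k + m + 1) ≤ S.w k (k + m) * S.w (k + m + 1) (k + m + 1) :=
      S.w_le_mul (by omega) le_rfl (by omega)
    have h3 : (S.w k (k + m + 1) : ℝ) ≤ S.w k (k + m) * S.lMax := by
      exact_mod_cast h2.trans (Nat.mul_le_mul_left _ (S.w_self_le _))
    rw [nIdx, h, ← add_assoc]
    nlinarith

/-- Every number `w(k, ·)` of words is unbounded. -/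
def WordsUnbounded : Prop := ∀ k (B : ℝ), ∃ m, B < (S.w k (k + m) : ℝ)

variable {S}

theorem WordsUnbounded.lt_w_nIdx (hU : S.WordsUnbounded) (ε : ℝ) (k : ℕ) :
    1 / ε < (S.w k (S.nIdx ε k) : ℝ) :=
  Nat.sInf_mem (hU k (1 / ε))

theorem WordsUnbounded.le_nIdx (hU : S.WordsUnbounded) {ε : ℝ} {k N : ℕ}
    (h : (S.w k N : ℝ) ≤ 1 / ε) : N ≤ S.nIdx ε k := by
  by_contra hlt
  have h1 : (S.w k (S.nIdx ε k) : ℝ) ≤ S.w k N := by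
    exact_mod_cast S.w_mono (S.le_nIdx_self ε k) (not_le.1 hlt).le
  exact absurd (hU.lt_w_nIdx ε k) (not_lt.2 (h1.trans h))

theorem WordsUnbounded.nIdx_anti (hU : S.WordsUnbounded) {ε ε' : ℝ} (hε : 0 < ε') (h : ε' ≤ ε)
    (k : ℕ) : S.nIdx ε k ≤ S.nIdx ε' k :=
  Nat.add_le_add_left (Nat.sInf_le ((one_div_le_one_div_of_le hε h).trans_lt
    (hU.lt_w_nIdx ε' k))) _

theorem WordsUnbounded.nTilde_anti (hU : S.WordsUnbounded) {ε ε' : ℝ} (hε : 0 < ε') (h : ε' ≤ ε)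
    (k : ℕ) : S.nTilde ε k ≤ S.nTilde ε' k :=
  Finset.sup_mono_fun fun i _ => hU.nIdx_anti hε h i

/-- Offsets the shift between `ñ_n` and a join over `n + 1` times. Only the window starting at `k +
1` is new; starting it at `k` instead multiplies the number of words by at most `lMax`, which a
smaller `ε'` accommodates. -/
theorem WordsUnbounded.exists_nTilde_succ_le (hU : S.WordsUnbounded) {ε : ℝ} (hε : 0 < ε) :
    ∃ ε' : ℝ, 0 < ε' ∧ ∀ k, S.nTilde ε (k + 1) ≤ S.nTilde ε' k := by
  have hl : (1 : ℝ) ≤ S.lMax := by exact_mod_cast S.lMax_pos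
  have he : 0 < 1 / ε := one_div_pos.2 hε
  have hpos : (0 : ℝ) < S.lMax * (S.lMax * (1 + 1 / ε)) := by positivity
  refine ⟨1 / (S.lMax * (S.lMax * (1 + 1 / ε))), one_div_pos.2 hpos, fun k => ?_⟩
  obtain ⟨i, hi, h⟩ := S.exists_nTilde_eq ε (k + 1)
  rw [h]
  have h1 := S.w_nIdx_le hε i
  rcases hi.lt_or_eq with hi | rfl
  · refine le_trans (hU.le_nIdx ?_) (S.nIdx_le_nTilde _ (Nat.lt_succ_iff.1 hi))
    rw [one_div_one_div]
    refine h1.trans ?_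
    nlinarith
  · refine le_trans (hU.le_nIdx ?_) (S.nIdx_le_nTilde _ le_rfl)
    rw [one_div_one_div]
    have h2 : S.w k (S.nIdx ε (k + 1)) ≤ S.w k k * S.w (k + 1) (S.nIdx ε (k + 1)) :=
      S.w_le_mul (by omega) le_rfl ((Nat.le_succ k).trans (S.le_nIdx_self _ _))
    have h3 : (S.w k (S.nIdx ε (k + 1)) : ℝ) ≤ S.lMax * S.w (k + 1) (S.nIdx ε (k + 1)) := by
      exact_mod_cast h2.trans (Nat.mul_le_mul_right _ (S.w_self_le _))
    exact h3.trans (mul_le_mul_of_nonneg_left h1 (by positivity))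

/-- A window at scale `ε'` followed by one at scale `ε` still carries boundedly many words, so it
fits into one window at a finer scale. -/
theorem WordsUnbounded.exists_nIdx_nTilde_le (hU : S.WordsUnbounded) {ε ε' : ℝ} (hε : 0 < ε)
    (hε' : 0 < ε') :
    ∃ ε'' : ℝ, 0 < ε'' ∧ ∀ k, S.nIdx ε (S.nTilde ε' k) ≤ S.nTilde ε'' k := by
  have hl : (1 : ℝ) ≤ S.lMax := by exact_mod_cast S.lMax_pos
  have he : 0 < 1 / ε := one_div_pos.2 hε
  have he' : 0 < 1 / ε' := one_div_pos.2 hε'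
  have hpos : (0 : ℝ) < (S.lMax * (1 + 1 / ε')) * (S.lMax * (1 + 1 / ε)) := by positivity
  refine ⟨1 / ((S.lMax * (1 + 1 / ε')) * (S.lMax * (1 + 1 / ε))), one_div_pos.2 hpos,
    fun k => ?_⟩
  obtain ⟨i, hi, h⟩ := S.exists_nTilde_eq ε' k
  refine le_trans (hU.le_nIdx ?_) (S.nIdx_le_nTilde _ hi)
  rw [one_div_one_div, h]
  have h2 : S.w i (S.nIdx ε (S.nIdx ε' i)) ≤
      S.w i (S.nIdx ε' i) * S.w (S.nIdx ε' i) (S.nIdx ε (S.nIdx ε' i)) :=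
    S.w_le_mul (S.le_nIdx_self _ _) (Nat.le_succ _) (S.le_nIdx_self _ _)
  have h3 : (S.w i (S.nIdx ε (S.nIdx ε' i)) : ℝ) ≤
      S.w i (S.nIdx ε' i) * S.w (S.nIdx ε' i) (S.nIdx ε (S.nIdx ε' i)) := by exact_mod_cast h2
  exact h3.trans (mul_le_mul (S.w_nIdx_le hε' _) (S.w_nIdx_le hε _) (Nat.cast_nonneg _)
    (by positivity))

end

end NSFT

/-! ### The Parry measures: cylinders, invariance, and the entropy of words. -/

namespace NSFT

noncomputable section

variable {S : NSFT} {wh vh : ∀ i, Fin (S.l i) → ℝ} {μ : ∀ k, Measure (S.Space k)}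

theorem IsParry.wh_pos (hμ : S.IsParry wh vh μ) (i : ℕ) (a : Fin (S.l i)) : 0 < wh i a :=
  hμ.1.1 i a

theorem IsParry.vh_pos (hμ : S.IsParry wh vh μ) (i : ℕ) (a : Fin (S.l i)) : 0 < vh i a :=
  hμ.2.1.1 i a

theorem IsParry.dotProduct_pos (hμ : S.IsParry wh vh μ) (k : ℕ) : 0 < vh k ⬝ᵥ wh k :=
  Finset.sum_pos (fun a _ => mul_pos (hμ.vh_pos k a) (hμ.wh_pos k a))
    ⟨⟨0, S.l_pos k⟩, Finset.mem_univ _⟩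

/-- Both sides of `v̂_k L_k ŵ_{k+1}` are evaluated; hence a single normalizing constant serves all
times. -/
theorem IsParry.dotProduct_eq (hμ : S.IsParry wh vh μ) (k : ℕ) :
    vh k ⬝ᵥ wh k = vh 0 ⬝ᵥ wh 0 := by
  induction k with
  | zero => rfl
  | succ k ih => rw [← ih, ← hμ.2.1.2 k, hμ.1.2 k, Matrix.dotProduct_mulVec]

theorem IsParry.colNorm_pos (hμ : S.IsParry wh vh μ) (k : ℕ) : 0 < S.colNorm wh k :=
  Finset.sum_pos (fun a _ => abs_pos.2 (hμ.wh_pos k a).ne')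
    ⟨⟨0, S.l_pos k⟩, Finset.mem_univ _⟩

theorem IsParry.parryVec_eq (hμ : S.IsParry wh vh μ) (k : ℕ) (a : Fin (S.l k)) :
    S.parryVec wh vh k a = vh k a * wh k a / (vh 0 ⬝ᵥ wh 0) := by
  have hN := (hμ.colNorm_pos k).ne'
  have hc := (hμ.dotProduct_pos k).ne'
  have h : vh k ⬝ᵥ S.colNormalized wh k = (vh k ⬝ᵥ wh k) / S.colNorm wh k := by
    simp only [dotProduct, colNormalized, Finset.sum_div, mul_div_assoc]
  rw [parryVec, rowNormalized, h, ← hμ.dotProduct_eq k, colNormalized]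
  field_simp

theorem IsParry.parryVec_pos (hμ : S.IsParry wh vh μ) (k : ℕ) (a : Fin (S.l k)) :
    0 < S.parryVec wh vh k a := by
  rw [hμ.parryVec_eq]
  exact div_pos (mul_pos (hμ.vh_pos k a) (hμ.wh_pos k a)) (hμ.dotProduct_pos 0)

theorem IsParry.parryMat_eq (hμ : S.IsParry wh vh μ) (k : ℕ) (a : Fin (S.l k))
    (b : Fin (S.l (k + 1))) :
    S.parryMat wh k a b = S.L k a b * (wh (k + 1) b / wh k a) := by
  have hN := (hμ.colNorm_pos k).ne'
  have hN' := (hμ.colNorm_pos (k + 1)).ne'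
  have ha := (hμ.wh_pos k a).ne'
  have hinv : (Matrix.diagonal (S.colNormalized wh k))⁻¹ =
      Matrix.diagonal fun a => (S.colNormalized wh k a)⁻¹ := by
    refine Matrix.inv_eq_right_inv ?_
    rw [Matrix.diagonal_mul_diagonal, ← Matrix.diagonal_one]
    congr 1
    funext a
    exact mul_inv_cancel₀ (div_pos (hμ.wh_pos k a) (hμ.colNorm_pos k)).ne'
  rw [parryMat, hinv, Matrix.smul_apply, Matrix.mul_diagonal, Matrix.diagonal_mul, smul_eq_mul,
    colNormalized, colNormalized, eig]
  field_simp

/-- Along an admissible word the transition probabilities are `ŵ_{i+1} / ŵ_i`, so their product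
telescopes and only the two end letters matter. -/
theorem IsParry.measure_pref (hμ : S.IsParry wh vh μ) {k m : ℕ} (hkm : k ≤ m) {x : S.Word k m}
    (hx : x ∈ S.admWords k m) :
    μ k (S.pref m ⁻¹' {x}) = ENNReal.ofReal (vh k (x ⟨k, le_rfl, hkm⟩) *
      wh m (x ⟨m, hkm, le_rfl⟩) / (vh 0 ⬝ᵥ wh 0)) := by
  rw [← cylinder_eq_preimage, hμ.2.2 k m hkm x]
  congr 1
  -- The value `1` outside `[k, m]` makes the telescoping product one over natural numbers.
  let u : ℕ → ℝ := fun i => if h : i ∈ Set.Icc k m then wh i (x ⟨i, h⟩) else 1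
  have hu : ∀ i (h : i ∈ Set.Icc k m), u i = wh i (x ⟨i, h⟩) := fun i h => dif_pos h
  have hu0 : ∀ i, u i ≠ 0 := by
    intro i
    simp only [u]
    split_ifs
    · exact (hμ.wh_pos _ _).ne'
    · exact one_ne_zero
  have h1 : ∏ i : Set.Ico k m, S.parryMat wh i (x ⟨i, i.2.1, i.2.2.le⟩)
      (x ⟨i + 1, Nat.le_succ_of_le i.2.1, i.2.2⟩) = ∏ i ∈ Finset.Ico k m, u (i + 1) / u i := by
    rw [Finset.prod_subtype (p := fun i => i ∈ Set.Ico k m) (Finset.Ico k m)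
      (fun i => by simp) (fun i => u (i + 1) / u i)]
    refine Finset.prod_congr rfl fun i _ => ?_
    rw [hμ.parryMat_eq, hx i i.2.1 i.2.2, one_mul, hu i ⟨i.2.1, i.2.2.le⟩,
      hu (i + 1) ⟨Nat.le_succ_of_le i.2.1, i.2.2⟩]
  have h2 : ∀ m', k ≤ m' → ∏ i ∈ Finset.Ico k m', u (i + 1) / u i = u m' / u k := by
    intro m' h
    induction m', h using Nat.le_induction with
    | base => simp [hu0]
    | succ j hj ih =>
      rw [Finset.prod_Ico_succ_top hj, ih]
      have := hu0 j
      have := hu0 k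
      field_simp
  have hk := hu0 k
  rw [h1, h2 m hkm, hu m ⟨hkm, le_rfl⟩, hμ.parryVec_eq, ← hu k ⟨le_rfl, hkm⟩]
  field_simp

theorem pref_preimage_eq_empty {k m : ℕ} {x : S.Word k m} (hx : x ∉ S.admWords k m) :
    S.pref m ⁻¹' {x} = (∅ : Set (S.Space k)) := by
  ext y
  simp only [Set.mem_preimage, Set.mem_singleton_iff, Set.mem_empty_iff_false, iff_false]
  rintro rfl
  exact hx (S.pref_mem_admWords m y)

theorem IsParry.measure_seq_eq (hμ : S.IsParry wh vh μ) (k : ℕ) (a : Fin (S.l k)) :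
    μ k {y | y.seq ⟨k, le_refl k⟩ = a} = ENNReal.ofReal (S.parryVec wh vh k a) := by
  let x : S.Word k k := Function.update (fun i => ⟨0, S.l_pos i⟩) ⟨k, le_rfl, le_rfl⟩ a
  have hxk : x ⟨k, le_rfl, le_rfl⟩ = a := Function.update_self _ _ _
  have hset : {y : S.Space k | y.seq ⟨k, le_refl k⟩ = a} = S.pref k ⁻¹' {x} := by
    ext y
    constructor
    · intro h
      funext ⟨i, hi⟩
      obtain rfl : i = k := le_antisymm hi.2 hi.1
      exact h.trans hxk.symm
    · intro h
      exact (congrFun h ⟨k, le_rfl, le_rfl⟩).trans hxk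
  have hx : x ∈ S.admWords k k := fun i h1 h2 => by omega
  rw [hset, hμ.measure_pref le_rfl hx, hxk, hμ.parryVec_eq]

theorem measurableSet_seq_eq (k j : ℕ) (hj : k ≤ j) (a : Fin (S.l j)) :
    MeasurableSet {y : S.Space k | y.seq ⟨j, hj⟩ = a} :=
  S.measurableSet_pref_preimage j {x | x ⟨j, hj, le_rfl⟩ = a}

theorem IsParry.sum_parryVec (hμ : S.IsParry wh vh μ) (k : ℕ) :
    ∑ a, S.parryVec wh vh k a = 1 := by
  simp only [hμ.parryVec_eq, ← Finset.sum_div]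
  have := hμ.dotProduct_eq k
  rw [dotProduct] at this
  rw [this, div_self (hμ.dotProduct_pos 0).ne']

theorem IsParry.isProbabilityMeasure (hμ : S.IsParry wh vh μ) (k : ℕ) :
    IsProbabilityMeasure (μ k) := by
  constructor
  have : (Set.univ : Set (S.Space k)) =
      ⋃ a : Fin (S.l k), {y : S.Space k | y.seq ⟨k, le_refl k⟩ = a} := by
    ext y
    simp
  rw [this, measure_iUnion, tsum_fintype]
  · simp only [hμ.measure_seq_eq]
    rw [← ENNReal.ofReal_sum_of_nonneg fun a _ => (hμ.parryVec_pos k a).le, hμ.sum_parryVec,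
      ENNReal.ofReal_one]
  · intro a b hab
    refine Set.disjoint_left.2 fun y (ha : _ = a) (hb : _ = b) => hab (ha.symm.trans hb)
  · exact fun a => measurableSet_seq_eq _ _ _ _

/-- The word `a x`. -/
def consWord {k m : ℕ} (hkm : k ≤ m) (a : Fin (S.l k)) (x : S.Word (k + 1) m) : S.Word k m :=
  Function.update (fun i => if h : k + 1 ≤ i then x ⟨i, h, i.2.2⟩ else ⟨0, S.l_pos i⟩)
    ⟨k, le_rfl, hkm⟩ a

theorem consWord_self {k m : ℕ} (hkm : k ≤ m) (a : Fin (S.l k)) (x : S.Word (k + 1) m) :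
    consWord hkm a x ⟨k, le_rfl, hkm⟩ = a :=
  Function.update_self _ _ _

theorem consWord_of_lt {k m : ℕ} (hkm : k ≤ m) (a : Fin (S.l k)) (x : S.Word (k + 1) m) {i : ℕ}
    (h1 : k ≤ i) (hi : k + 1 ≤ i) (him : i ≤ m) :
    consWord hkm a x ⟨i, h1, him⟩ = x ⟨i, hi, him⟩ := by
  have hne : (⟨i, h1, him⟩ : Set.Icc k m) ≠ ⟨k, le_rfl, hkm⟩ := by
    intro e
    have := congrArg Subtype.val e
    simp only at this
    omega
  rw [consWord, Function.update_of_ne hne, dif_pos hi]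

theorem shift_preimage_pref {k m : ℕ} (hkm : k + 1 ≤ m) (x : S.Word (k + 1) m) :
    S.shift k ⁻¹' (S.pref m ⁻¹' {x}) =
      ⋃ a, S.pref m ⁻¹' {consWord (Nat.le_of_succ_le hkm) a x} := by
  ext y
  simp only [Set.mem_preimage, Set.mem_singleton_iff, Set.mem_iUnion]
  constructor
  · intro h
    refine ⟨y.seq ⟨k, le_refl k⟩, funext fun ⟨i, hi⟩ => ?_⟩
    rcases hi.1.eq_or_lt with rfl | hlt
    · rw [consWord_self]
      rfl
    · rw [consWord_of_lt _ _ _ hi.1 hlt hi.2, ← h]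
      rfl
  · rintro ⟨a, h⟩
    funext ⟨i, hi⟩
    rw [← consWord_of_lt (Nat.le_of_succ_le hkm) a x (Nat.le_of_succ_le hi.1) hi.1 hi.2, ← h]
    rfl

theorem consWord_mem_admWords_iff {k m : ℕ} (hkm : k + 1 ≤ m) (a : Fin (S.l k))
    {x : S.Word (k + 1) m} (hx : x ∈ S.admWords (k + 1) m) :
    consWord (Nat.le_of_succ_le hkm) a x ∈ S.admWords k m ↔
      S.L k a (x ⟨k + 1, le_rfl, hkm⟩) = 1 := by
  constructor
  · intro h
    have := h k le_rfl hkm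
    rwa [consWord_self, consWord_of_lt _ _ _ (Nat.le_succ k) le_rfl hkm] at this
  · intro h i hn him
    rcases hn.eq_or_lt with rfl | hlt
    · rwa [consWord_self, consWord_of_lt _ _ _ (Nat.le_succ k) le_rfl hkm]
    · rw [consWord_of_lt _ _ _ hn hlt (Nat.le_of_succ_le him),
        consWord_of_lt _ _ _ (Nat.le_succ_of_le hn) (Nat.le_succ_of_le hlt) him]
      exact hx i hlt him

/-- Summing over the letter put in front turns `v̂_k` into `v̂_k L_k = v̂_{k+1}`: the row equation
is the invariance of the measures. -/
theorem IsParry.measure_shift_preimage_pref (hμ : S.IsParry wh vh μ) {k m : ℕ} (hkm : k + 1 ≤ m)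
    (x : S.Word (k + 1) m) :
    μ k (S.shift k ⁻¹' (S.pref m ⁻¹' {x})) = μ (k + 1) (S.pref m ⁻¹' {x}) := by
  by_cases hx : x ∈ S.admWords (k + 1) m
  swap
  · rw [pref_preimage_eq_empty hx]
    simp
  have hc := hμ.dotProduct_pos 0
  rw [shift_preimage_pref hkm, measure_iUnion, tsum_fintype]
  · have h1 : ∀ a, μ k (S.pref m ⁻¹' {consWord (Nat.le_of_succ_le hkm) a x}) = ENNReal.ofReal
        (vh k a * S.L k a (x ⟨k + 1, le_rfl, hkm⟩) *
          (wh m (x ⟨m, hkm, le_rfl⟩) / (vh 0 ⬝ᵥ wh 0))) := by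
      intro a
      rcases S.zero_one k a (x ⟨k + 1, le_rfl, hkm⟩) with h | h
      · rw [pref_preimage_eq_empty, h]
        · simp
        · rw [consWord_mem_admWords_iff hkm a hx, h]
          exact zero_ne_one
      · rw [hμ.measure_pref (Nat.le_of_succ_le hkm) ((consWord_mem_admWords_iff hkm a hx).2 h),
          consWord_self, consWord_of_lt _ _ _ (Nat.le_of_succ_le hkm) hkm le_rfl, h, mul_one,
          mul_div_assoc]
    have hw := hμ.wh_pos m (x ⟨m, hkm, le_rfl⟩)
    simp only [h1]
    rw [← ENNReal.ofReal_sum_of_nonneg, ← Finset.sum_mul, hμ.measure_pref hkm hx, mul_div_assoc,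
      ← hμ.2.1.2 k]
    · rfl
    · intro a _
      have := hμ.vh_pos k a
      have : 0 ≤ S.L k a (x ⟨k + 1, le_rfl, hkm⟩) := by
        rcases S.zero_one k a (x ⟨k + 1, le_rfl, hkm⟩) with h | h <;> simp [h]
      positivity
  · intro a b hab
    refine Set.disjoint_left.2 fun y (ha : _ = _) (hb : _ = _) => hab ?_
    have := congrFun (ha.symm.trans hb) ⟨k, le_rfl, Nat.le_of_succ_le hkm⟩
    rwa [consWord_self, consWord_self] at this
  · exact fun a => S.measurableSet_pref_preimage _ _

/-- Two cylinders are nested or disjoint. -/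
theorem isPiSystem_pref (k : ℕ) :
    IsPiSystem {A : Set (S.Space k) | ∃ m, k ≤ m ∧ ∃ x : S.Word k m, A = S.pref m ⁻¹' {x}} := by
  have key : ∀ (m m' : ℕ) (x : S.Word k m) (x' : S.Word k m'), m ≤ m' →
      ((S.pref m ⁻¹' {x} : Set (S.Space k)) ∩ S.pref m' ⁻¹' {x'}).Nonempty →
      (S.pref m ⁻¹' {x} : Set (S.Space k)) ∩ S.pref m' ⁻¹' {x'} = S.pref m' ⁻¹' {x'} := by
    rintro m m' x x' h ⟨y, hy, hy'⟩
    refine Set.inter_eq_right.2 fun z hz => ?_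
    have : S.pref m' z = S.pref m' y := Eq.trans hz (Eq.symm hy')
    exact (S.pref_eq_of_le h this).trans hy
  rintro _ ⟨m, hm, x, rfl⟩ _ ⟨m', hm', x', rfl⟩ hne
  rcases le_total m m' with h | h
  · exact ⟨m', hm', x', key m m' x x' h hne⟩
  · rw [Set.inter_comm] at hne ⊢
    exact ⟨m, hm, x, key m' m x' x h hne⟩

theorem measurable_shift (k : ℕ) : Measurable (S.shift k) := by
  refine Measurable.mono (measurable_generateFrom ?_) le_rfl
    (S.borel_eq_generateFrom_pref (k + 1)).le
  rintro _ ⟨m, hm, x, rfl⟩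
  rw [shift_preimage_pref hm]
  exact MeasurableSet.iUnion fun a => S.measurableSet_pref_preimage _ _

theorem IsParry.measurePreserving_shift (hμ : S.IsParry wh vh μ) (k : ℕ) :
    MeasurePreserving (S.shift k) (μ k) (μ (k + 1)) := by
  have := hμ.isProbabilityMeasure k
  have := hμ.isProbabilityMeasure (k + 1)
  have := Measure.isProbabilityMeasure_map (μ := μ k) (measurable_shift k).aemeasurable
  refine ⟨measurable_shift k, ?_⟩
  refine ext_of_generate_finite _ (S.borel_eq_generateFrom_pref (k + 1)) (isPiSystem_pref _) ?_ ?_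
  · rintro _ ⟨m, hm, x, rfl⟩
    rw [Measure.map_apply (measurable_shift k) (S.measurableSet_pref_preimage _ _)]
    exact hμ.measure_shift_preimage_pref hm x
  · simp

theorem IsParry.measurePreserving_iter (hμ : S.IsParry wh vh μ) :
    ∀ n, MeasurePreserving (NDS.iter S.shift n) (μ 0) (μ n)
  | 0 => MeasurePreserving.id _
  | n + 1 => (hμ.measurePreserving_shift n).comp (hμ.measurePreserving_iter n)

theorem IsParry.real_seq_eq (hμ : S.IsParry wh vh μ) (n : ℕ) (b : Fin (S.l n)) :
    (μ 0).real {y | y.seq ⟨n, Nat.zero_le n⟩ = b} = S.parryVec wh vh n b := by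
  have h := (hμ.measurePreserving_iter n).measure_preimage
    (measurableSet_seq_eq n n le_rfl b).nullMeasurableSet
  have hset : NDS.iter S.shift n ⁻¹' {y | y.seq ⟨n, le_refl n⟩ = b} =
      {y | y.seq ⟨n, Nat.zero_le n⟩ = b} := by
    ext y
    simp only [Set.mem_preimage, Set.mem_ofPred_eq, iter_shift_seq]
  rw [hset, hμ.measure_seq_eq] at h
  rw [measureReal_def, h, ENNReal.toReal_ofReal (hμ.parryVec_pos n b).le]

theorem IsParry.real_pref (hμ : S.IsParry wh vh μ) {n : ℕ} {x : S.Word 0 n}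
    (hx : x ∈ S.admWords 0 n) :
    (μ 0).real (S.pref n ⁻¹' {x}) = vh 0 (x ⟨0, le_rfl, Nat.zero_le n⟩) *
      wh n (x ⟨n, Nat.zero_le n, le_rfl⟩) / (vh 0 ⬝ᵥ wh 0) := by
  rw [measureReal_def, hμ.measure_pref (Nat.zero_le n) hx, ENNReal.toReal_ofReal]
  exact div_nonneg (mul_nonneg (hμ.vh_pos _ _).le (hμ.wh_pos _ _).le) (hμ.dotProduct_pos 0).le

/-- The cylinder of an admissible word has positive measure, and so has its preimage in `Σ^0`. -/
theorem IsParry.exists_pref_iter_eq (hμ : S.IsParry wh vh μ) {k n : ℕ} (hkn : k ≤ n)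
    {x : S.Word k n} (hx : x ∈ S.admWords k n) :
    ∃ y : S.Space 0, S.pref n (NDS.iter S.shift k y) = x := by
  have h := (hμ.measurePreserving_iter k).measure_preimage
    (S.measurableSet_pref_preimage n {x}).nullMeasurableSet
  rw [hμ.measure_pref hkn hx] at h
  have hpos : 0 < μ 0 (NDS.iter S.shift k ⁻¹' (S.pref n ⁻¹' {x})) := by
    rw [h, ENNReal.ofReal_pos]
    exact div_pos (mul_pos (hμ.vh_pos _ _) (hμ.wh_pos _ _)) (hμ.dotProduct_pos 0)
  exact nonempty_of_measure_ne_zero hpos.ne'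

theorem matProd_nonneg {k n : ℕ} (h : k ≤ n) : ∀ a b, 0 ≤ S.matProd h a b := by
  induction n, h using Nat.le_induction with
  | base =>
    intro a b
    rw [matProd_self, Matrix.one_apply]
    split_ifs <;> norm_num
  | succ n h ih =>
    intro a b
    rw [matProd_succ S h, Matrix.mul_apply]
    refine Finset.sum_nonneg fun j _ => mul_nonneg (ih a j) ?_
    rcases S.zero_one n j b with h | h <;> simp [h]

theorem matProd_trans {k m n : ℕ} (h : k ≤ m) (h' : m ≤ n) :
    S.matProd (h.trans h') = S.matProd h * S.matProd h' := by
  induction n, h' using Nat.le_induction with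
  | base => rw [matProd_self, Matrix.mul_one]
  | succ n h' ih => rw [matProd_succ S h', ← Matrix.mul_assoc, ← ih, matProd_succ]

theorem colSum_nonneg (k : ℕ) (b : Fin (S.l k)) : 0 ≤ S.colSum k b :=
  Finset.sum_nonneg fun _ _ => matProd_nonneg _ _ _

theorem colSum_eq_sum {k n : ℕ} (h : k ≤ n) (b : Fin (S.l n)) :
    S.colSum n b = ∑ a, S.colSum k a * S.matProd h a b := by
  simp only [colSum, Finset.sum_mul]
  rw [Finset.sum_comm]
  refine Finset.sum_congr rfl fun α _ => ?_
  rw [matProd_trans (Nat.zero_le k) h, Matrix.mul_apply]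

theorem colSum_mul_le {k n : ℕ} (h : k ≤ n) (a : Fin (S.l k)) (b : Fin (S.l n)) :
    S.colSum k a * S.matProd h a b ≤ S.colSum n b := by
  rw [colSum_eq_sum h]
  exact Finset.single_le_sum (f := fun a => S.colSum k a * S.matProd h a b)
    (fun a _ => mul_nonneg (colSum_nonneg k a) (matProd_nonneg _ _ _)) (Finset.mem_univ a)

/-- No column of any `L_i` vanishes. All logarithms of column sums are therefore nonnegative. -/
theorem one_le_colSum (n : ℕ) : ∀ b, 1 ≤ S.colSum n b := by
  induction n with
  | zero =>
    intro b
    simp [colSum, matProd_self, Matrix.one_apply]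
  | succ n ih =>
    intro b
    obtain ⟨a, ha⟩ := S.col_ne_zero n b
    have h1 := (S.zero_one n a b).resolve_left ha
    have h2 := colSum_mul_le (Nat.le_succ n) a b
    rw [matProd_succ S le_rfl, matProd_self, Matrix.one_mul, h1, mul_one] at h2
    exact (ih a).trans h2

theorem IsParry.vh_eq_sum (hμ : S.IsParry wh vh μ) (n : ℕ) :
    ∀ b, vh n b = ∑ a, vh 0 a * S.matProd (Nat.zero_le n) a b := by
  suffices h : vh n = Matrix.vecMul (vh 0) (S.matProd (Nat.zero_le n)) from fun b => congrFun h b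
  induction n with
  | zero => rw [matProd_self, Matrix.vecMul_one]
  | succ n ih => rw [matProd_succ S (Nat.zero_le n), ← Matrix.vecMul_vecMul, ← ih, hμ.2.1.2]

/-- `A` and `B` are the least and the greatest entry of `v̂_0`, and `v̂_n = v̂_0 L^{(0,n)}`. -/
theorem IsParry.exists_colSum_le_vh (hμ : S.IsParry wh vh μ) :
    ∃ A B : ℝ, 0 < A ∧ 0 < B ∧ (∀ a, A ≤ vh 0 a) ∧ (∀ a, vh 0 a ≤ B) ∧
      ∀ n b, A * S.colSum n b ≤ vh n b ∧ vh n b ≤ B * S.colSum n b := by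
  have : Nonempty (Fin (S.l 0)) := ⟨⟨0, S.l_pos 0⟩⟩
  obtain ⟨a, ha⟩ := Finite.exists_min (vh 0)
  obtain ⟨b, hb⟩ := Finite.exists_max (vh 0)
  refine ⟨vh 0 a, vh 0 b, hμ.vh_pos _ _, hμ.vh_pos _ _, ha, hb, fun n c => ?_⟩
  rw [hμ.vh_eq_sum n c, colSum, Finset.mul_sum, Finset.mul_sum]
  exact ⟨Finset.sum_le_sum fun i _ => mul_le_mul_of_nonneg_right (ha i) (matProd_nonneg _ _ _),
    Finset.sum_le_sum fun i _ => mul_le_mul_of_nonneg_right (hb i) (matProd_nonneg _ _ _)⟩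

/-- Links word counts to column sums through the measure: `v̂_0(x_0)` is the mass of the cylinder
times `c / ŵ_n(x_n)`, `c = v̂_0 ŵ_0`, and the mean of `c / ŵ_n` under `π_n` is the sum of `v̂_n`. -/
theorem IsParry.sum_vh_eq (hμ : S.IsParry wh vh μ) (n : ℕ) :
    ∑ x ∈ (S.admWords 0 n).toFinite.toFinset, vh 0 (x ⟨0, le_rfl, Nat.zero_le n⟩) =
      ∑ b, vh n b := by
  classical
  have := hμ.isProbabilityMeasure 0
  have hc := (hμ.dotProduct_pos 0).ne'
  have h := NDS.sum_real_fiber_mul (μ := μ 0) (X := S.pref n)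
    (fun x => S.measurableSet_pref_preimage n {x})
    (fun x => x ⟨n, Nat.zero_le n, le_rfl⟩) (fun b => (vh 0 ⬝ᵥ wh 0) / wh n b)
  have h1 : ∀ b, {y | S.pref n y ⟨n, Nat.zero_le n, le_rfl⟩ = b} =
    {y : S.Space 0 | y.seq ⟨n, Nat.zero_le n⟩ = b} := fun b => rfl
  simp only [h1, hμ.real_seq_eq, hμ.parryVec_eq] at h
  have h2 : ∀ b, vh n b * wh n b / (vh 0 ⬝ᵥ wh 0) * ((vh 0 ⬝ᵥ wh 0) / wh n b) = vh n b := by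
    intro b
    have := (hμ.wh_pos n b).ne'
    field_simp
  simp only [h2] at h
  rw [← h]
  have h3 := Finset.sum_subset (Finset.subset_univ (S.admWords 0 n).toFinite.toFinset)
    (f := fun x => (μ 0).real (S.pref n ⁻¹' {x}) *
      ((vh 0 ⬝ᵥ wh 0) / wh n (x ⟨n, Nat.zero_le n, le_rfl⟩))) (by
      intro x _ hx
      rw [pref_preimage_eq_empty (by simpa using hx)]
      simp)
  rw [← h3]
  refine Finset.sum_congr rfl fun x hx => ?_
  have := (hμ.wh_pos n (x ⟨n, Nat.zero_le n, le_rfl⟩)).ne'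
  rw [hμ.real_pref (by simpa using hx)]
  field_simp

theorem w_eq_card (n m : ℕ) : S.w n m = (S.admWords n m).toFinite.toFinset.card :=
  Set.ncard_eq_toFinset_card _ _

/-- Column sums of `L^{(0,n)}` and `w(0,n)` are comparable. -/
theorem IsParry.exists_colSum_w (hμ : S.IsParry wh vh μ) :
    ∃ K : ℝ, 1 ≤ K ∧ ∀ n, (∀ b, S.colSum n b ≤ K * S.w 0 n) ∧
      (S.w 0 n : ℝ) ≤ K * ∑ b, S.colSum n b := by
  obtain ⟨A, B, hA, hB, h0A, h0B, h⟩ := hμ.exists_colSum_le_vh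
  have hAB : A ≤ B := (h0A ⟨0, S.l_pos 0⟩).trans (h0B _)
  refine ⟨B / A, (one_le_div hA).2 hAB, fun n => ?_⟩
  have hs := hμ.sum_vh_eq n
  constructor
  · intro b
    have h1 : A * S.colSum n b ≤ B * S.w 0 n := by
      calc A * S.colSum n b ≤ vh n b := (h n b).1
        _ ≤ ∑ b, vh n b := Finset.single_le_sum (fun b _ => (hμ.vh_pos n b).le) (Finset.mem_univ b)
        _ ≤ ∑ x ∈ (S.admWords 0 n).toFinite.toFinset, B := by
          rw [← hs]
          exact Finset.sum_le_sum fun x _ => h0B _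
        _ = B * S.w 0 n := by
          rw [Finset.sum_const, nsmul_eq_mul, w_eq_card, mul_comm]
    rw [div_mul_eq_mul_div, le_div_iff₀ hA]
    linarith
  · have h1 : A * S.w 0 n ≤ B * ∑ b, S.colSum n b := by
      calc A * S.w 0 n = ∑ x ∈ (S.admWords 0 n).toFinite.toFinset, A := by
            rw [Finset.sum_const, nsmul_eq_mul, w_eq_card, mul_comm]
        _ ≤ ∑ b, vh n b := by
          rw [← hs]
          exact Finset.sum_le_sum fun x _ => h0A _
        _ ≤ B * ∑ b, S.colSum n b := by
          rw [Finset.mul_sum]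
          exact Finset.sum_le_sum fun b _ => (h n b).2
    rw [div_mul_eq_mul_div, le_div_iff₀ hA]
    linarith

/-- The expected logarithm of the column sums of `L^{(0,n)}`. -/
def meanLogColSum (S : NSFT) (wh vh : ∀ i, Fin (S.l i) → ℝ) (n : ℕ) : ℝ :=
  ∑ b, S.parryVec wh vh n b * Real.log (S.colSum n b)

/-- The core of (i). The entropy is the sum of three means: of `-log v̂_0(x_0)`, which is bounded;
of `-log π_n(x_n)`, the entropy of one letter; and of `log v̂_n(x_n)`, where `v̂_n` is comparable to
the column sums. -/
theorem IsParry.exists_abs_shannon_sub_le (hμ : S.IsParry wh vh μ) :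
    ∃ K : ℝ, ∀ n, |NDS.shannon (μ 0) (S.pref n : S.Space 0 → S.Word 0 n) -
      S.meanLogColSum wh vh n| ≤ K := by
  classical
  have := hμ.isProbabilityMeasure 0
  obtain ⟨A, B, hA, hB, h0A, h0B, h⟩ := hμ.exists_colSum_le_vh
  let T := |Real.log A| + |Real.log B|
  have hT : ∀ z, Real.log A ≤ z → z ≤ Real.log B → |z| ≤ T := by
    intro z h1 h2
    have := neg_abs_le (Real.log A)
    have := le_abs_self (Real.log B)
    have := abs_nonneg (Real.log A)
    have := abs_nonneg (Real.log B)
    exact abs_le.2 ⟨by simp only [T]; linarith, by simp only [T]; linarith⟩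
  refine ⟨T + S.lMax + T, fun n => ?_⟩
  let p : S.Word 0 n → ℝ := fun x => (μ 0).real (S.pref n ⁻¹' {x})
  have hX : ∀ x, MeasurableSet (S.pref n ⁻¹' {x} : Set (S.Space 0)) := fun x =>
    S.measurableSet_pref_preimage n {x}
  have hp1 : ∑ x, p x = 1 := NDS.sum_real_fiber_univ hX
  have hp0 : ∀ x, 0 ≤ p x := fun x => measureReal_nonneg
  have hexp := NDS.sum_real_fiber_mul (μ := μ 0) hX (fun x => x ⟨n, Nat.zero_le n, le_rfl⟩)
    (fun b => -Real.log (S.parryVec wh vh n b) + Real.log (vh n b))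
  have h1 : ∀ b, {y | S.pref n y ⟨n, Nat.zero_le n, le_rfl⟩ = b} =
    {y : S.Space 0 | y.seq ⟨n, Nat.zero_le n⟩ = b} := fun b => rfl
  simp only [h1, hμ.real_seq_eq] at hexp
  -- In the mass `v̂_0(x_0) ŵ_n(x_n) / c` the factor `ŵ_n / c` is replaced by `π_n / v̂_n`.
  have hterm : ∀ x, Real.negMulLog (p x) =
      p x * -Real.log (vh 0 (x ⟨0, le_rfl, Nat.zero_le n⟩)) +
      p x * (-Real.log (S.parryVec wh vh n (x ⟨n, Nat.zero_le n, le_rfl⟩)) +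
        Real.log (vh n (x ⟨n, Nat.zero_le n, le_rfl⟩))) := by
    intro x
    by_cases hx : x ∈ S.admWords 0 n
    · have e : p x = _ := hμ.real_pref hx
      have hv0 := (hμ.vh_pos 0 (x ⟨0, le_rfl, Nat.zero_le n⟩)).ne'
      have hv := (hμ.vh_pos n (x ⟨n, Nat.zero_le n, le_rfl⟩)).ne'
      have hw := (hμ.wh_pos n (x ⟨n, Nat.zero_le n, le_rfl⟩)).ne'
      have hc := (hμ.dotProduct_pos 0).ne'
      have e1 : Real.log (p x) = Real.log (vh 0 (x ⟨0, le_rfl, Nat.zero_le n⟩)) +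
          Real.log (S.parryVec wh vh n (x ⟨n, Nat.zero_le n, le_rfl⟩)) -
          Real.log (vh n (x ⟨n, Nat.zero_le n, le_rfl⟩)) := by
        rw [e, hμ.parryVec_eq, Real.log_div (mul_ne_zero hv0 hw) hc,
          Real.log_div (mul_ne_zero hv hw) hc, Real.log_mul hv0 hw, Real.log_mul hv hw]
        ring
      rw [Real.negMulLog, e1]
      ring
    · have : p x = 0 := by simp [p, pref_preimage_eq_empty hx]
      simp [this]
  have hsh : NDS.shannon (μ 0) (S.pref n : S.Space 0 → S.Word 0 n) =
      ∑ x, p x * -Real.log (vh 0 (x ⟨0, le_rfl, Nat.zero_le n⟩)) +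
      (∑ b, Real.negMulLog (S.parryVec wh vh n b) +
        ∑ b, S.parryVec wh vh n b * Real.log (vh n b)) := by
    unfold NDS.shannon
    rw [Finset.sum_congr rfl fun x _ => hterm x, Finset.sum_add_distrib, hexp,
      ← Finset.sum_add_distrib]
    refine congrArg _ (Finset.sum_congr rfl fun b _ => ?_)
    rw [Real.negMulLog]
    ring
  have b1 : |∑ x, p x * -Real.log (vh 0 (x ⟨0, le_rfl, Nat.zero_le n⟩))| ≤ T := by
    refine (Finset.abs_sum_le_sum_abs _ _).trans ?_
    calc _ ≤ ∑ x, p x * T := by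
          refine Finset.sum_le_sum fun x _ => ?_
          rw [abs_mul, abs_of_nonneg (hp0 x), abs_neg]
          exact mul_le_mul_of_nonneg_left (hT _ (Real.log_le_log hA (h0A _))
            (Real.log_le_log (hμ.vh_pos _ _) (h0B _))) (hp0 x)
      _ = T := by rw [← Finset.sum_mul, hp1, one_mul]
  have hπ1 : ∀ b, S.parryVec wh vh n b ≤ 1 := fun b => by
    rw [← hμ.sum_parryVec n]
    exact Finset.single_le_sum (fun b _ => (hμ.parryVec_pos n b).le) (Finset.mem_univ b)
  -- From `log t ≥ 1 - 1/t` follows `-t log t ≤ 1`, for each of at most `lMax` letters.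
  have b2 : |∑ b, Real.negMulLog (S.parryVec wh vh n b)| ≤ S.lMax := by
    rw [abs_of_nonneg (Finset.sum_nonneg fun b _ =>
      Real.negMulLog_nonneg (hμ.parryVec_pos n b).le (hπ1 b))]
    calc _ ≤ ∑ b : Fin (S.l n), (1 : ℝ) := by
          refine Finset.sum_le_sum fun b _ => ?_
          have hb := hμ.parryVec_pos n b
          have := Real.one_sub_inv_le_log_of_pos hb
          have h2 := mul_le_mul_of_nonneg_left this hb.le
          rw [mul_sub, mul_inv_cancel₀ hb.ne'] at h2
          rw [Real.negMulLog]
          linarith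
      _ ≤ S.lMax := by
          simp only [Finset.sum_const, Finset.card_univ, Fintype.card_fin, nsmul_eq_mul, mul_one]
          exact_mod_cast S.l_le_lMax n
  have b3 : |∑ b, S.parryVec wh vh n b * Real.log (vh n b) - S.meanLogColSum wh vh n| ≤ T := by
    rw [meanLogColSum, ← Finset.sum_sub_distrib]
    refine (Finset.abs_sum_le_sum_abs _ _).trans ?_
    calc _ ≤ ∑ b, S.parryVec wh vh n b * T := by
          refine Finset.sum_le_sum fun b _ => ?_
          have hcs : 0 < S.colSum n b := zero_lt_one.trans_le (one_le_colSum n b)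
          rw [← mul_sub, abs_mul, abs_of_nonneg (hμ.parryVec_pos n b).le]
          refine mul_le_mul_of_nonneg_left (hT _ ?_ ?_) (hμ.parryVec_pos n b).le
          · have := Real.log_le_log (mul_pos hA hcs) (h n b).1
            rw [Real.log_mul hA.ne' hcs.ne'] at this
            linarith
          · have := Real.log_le_log (hμ.vh_pos n b) (h n b).2
            rw [Real.log_mul hB.ne' hcs.ne'] at this
            linarith
      _ = T := by rw [← Finset.sum_mul, hμ.sum_parryVec, one_mul]
  rw [hsh]
  have := abs_le.1 b1
  have := abs_le.1 b2
  have := abs_le.1 b3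
  refine abs_le.2 ⟨?_, ?_⟩ <;> linarith [this.1, this.2]

end

end NSFT

/-! ### Itineraries, growth rates in `EReal`, and finite subcovers. -/

namespace NDS

noncomputable section

variable {X : ℕ → Type*}

theorem PartitionSeq.exists_mem_cell [∀ n, MeasurableSpace (X n)] (P : PartitionSeq X) (n : ℕ)
    (y : X n) : ∃ i, y ∈ P.cell n i := by
  have : y ∈ ⋃ i, P.cell n i := by simp [P.cover n]
  exact Set.mem_iUnion.1 this

/-- The index of the cell containing a point. -/
def PartitionSeq.index [∀ n, MeasurableSpace (X n)] (P : PartitionSeq X) (n : ℕ) (y : X n) :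
    Fin (P.card n) :=
  (P.exists_mem_cell n y).choose

theorem PartitionSeq.mem_cell_iff [∀ n, MeasurableSpace (X n)] (P : PartitionSeq X) {n : ℕ}
    {y : X n} {i : Fin (P.card n)} : y ∈ P.cell n i ↔ P.index n y = i := by
  have h := (P.exists_mem_cell n y).choose_spec
  refine ⟨fun hi => ?_, ?_⟩
  · by_contra hne
    exact Set.disjoint_left.1 (P.disjoint n hne) h hi
  · rintro rfl
    exact h

/-- The itinerary of a point with respect to `𝒫_0, …, 𝒫_{n-1}`. -/
def PartitionSeq.itinerary [∀ n, MeasurableSpace (X n)] (P : PartitionSeq X)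
    (f : ∀ n, X n → X (n + 1)) (n : ℕ) (y : X 0) : ∀ i : Fin n, Fin (P.card i) :=
  fun i => P.index i (iter f i y)

theorem PartitionSeq.itinerary_preimage [∀ n, MeasurableSpace (X n)] (P : PartitionSeq X)
    (f : ∀ n, X n → X (n + 1)) (n : ℕ) (s : ∀ i : Fin n, Fin (P.card i)) :
    P.itinerary f n ⁻¹' {s} = ⋂ i : Fin n, iter f i ⁻¹' P.cell i (s i) := by
  ext y
  simp only [Set.mem_preimage, Set.mem_singleton_iff, Set.mem_iInter, P.mem_cell_iff]
  exact funext_iff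

theorem joinEntropy_eq_shannon [∀ n, MeasurableSpace (X n)] (P : PartitionSeq X)
    (f : ∀ n, X n → X (n + 1)) (μ : ∀ n, Measure (X n)) (n : ℕ) :
    joinEntropy f μ P n = shannon (μ 0) (P.itinerary f n) := by
  simp only [joinEntropy, shannon, P.itinerary_preimage]

theorem measurableSet_itinerary_preimage [∀ n, MeasurableSpace (X n)] (P : PartitionSeq X)
    {f : ∀ n, X n → X (n + 1)} (hf : ∀ n, Measurable (iter f n)) (n : ℕ)
    (s : ∀ i : Fin n, Fin (P.card i)) : MeasurableSet (P.itinerary f n ⁻¹' {s}) := by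
  rw [P.itinerary_preimage]
  exact MeasurableSet.iInter fun i => hf i (P.measurable _ _)

/-- After division by `k` the error tends to the finite limit `η`, which makes subadditivity of the
upper limit available in `EReal`. -/
theorem limsup_div_le {a b : ℕ → ℝ} (K η : ℝ) (h : ∀ᶠ k : ℕ in atTop, a k ≤ b k + K + k * η) :
    limsup (fun k : ℕ => ((1 / (k : ℝ) * a k : ℝ) : EReal)) atTop ≤
      limsup (fun k : ℕ => ((1 / (k : ℝ) * b k : ℝ) : EReal)) atTop + (η : EReal) := by
  have ht : Tendsto (fun k : ℕ => ((1 / (k : ℝ) * K + η : ℝ) : EReal)) atTop (𝓝 (η : EReal)) := by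
    refine (continuous_coe_real_ereal.tendsto η).comp ?_
    have := ((tendsto_const_div_atTop_nhds_zero_nat 1).mul_const K).add_const η
    simpa using this
  calc _ ≤ limsup ((fun k : ℕ => ((1 / (k : ℝ) * b k : ℝ) : EReal)) +
        fun k : ℕ => ((1 / (k : ℝ) * K + η : ℝ) : EReal)) atTop := by
        refine limsup_le_limsup ?_
        filter_upwards [h, eventually_gt_atTop 0] with k hk hk0
        have hk0' : (0 : ℝ) < k := by exact_mod_cast hk0
        rw [Pi.add_apply, ← EReal.coe_add, EReal.coe_le_coe_iff]
        have h1 := mul_le_mul_of_nonneg_left hk (one_div_pos.2 hk0').le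
        have h2 : 1 / (k : ℝ) * (b k + K + k * η) = 1 / k * b k + (1 / k * K + η) := by
          field_simp
          ring
        linarith
    _ ≤ _ := by
        have hl := ht.limsup_eq
        refine (EReal.limsup_add_le ?_ ?_).trans ?_ <;> rw [hl]
        · exact Or.inr (EReal.coe_ne_top _)
        · exact Or.inr (EReal.coe_ne_bot _)

theorem limsup_div_le_of_le_add_const {a b : ℕ → ℝ} (K : ℝ) (h : ∀ k, a k ≤ b k + K) :
    limsup (fun k : ℕ => ((1 / (k : ℝ) * a k : ℝ) : EReal)) atTop ≤
      limsup (fun k : ℕ => ((1 / (k : ℝ) * b k : ℝ) : EReal)) atTop := by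
  have := limsup_div_le (a := a) (b := b) K 0 (Eventually.of_forall fun k => by simpa using h k)
  simpa using this

theorem limsup_div_le_of_eventually_le {a b : ℕ → ℝ} (h : ∀ᶠ k in atTop, a k ≤ b k) :
    limsup (fun k : ℕ => ((1 / (k : ℝ) * a k : ℝ) : EReal)) atTop ≤
      limsup (fun k : ℕ => ((1 / (k : ℝ) * b k : ℝ) : EReal)) atTop := by
  have := limsup_div_le (a := a) (b := b) 0 0 (by simpa using h)
  simpa using this

theorem limsup_div_zero :
    limsup (fun k : ℕ => ((1 / (k : ℝ) * 0 : ℝ) : EReal)) atTop = 0 := by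
  simp

theorem limsup_div_nonneg {a : ℕ → ℝ} (h : ∀ k, 0 ≤ a k) :
    0 ≤ limsup (fun k : ℕ => ((1 / (k : ℝ) * a k : ℝ) : EReal)) atTop := by
  rw [← limsup_div_zero]
  exact limsup_div_le_of_eventually_le (Eventually.of_forall h)

theorem limsup_div_nonpos {a : ℕ → ℝ} (K : ℝ) (h : ∀ k, a k ≤ K) :
    limsup (fun k : ℕ => ((1 / (k : ℝ) * a k : ℝ) : EReal)) atTop ≤ 0 := by
  rw [← limsup_div_zero]
  exact limsup_div_le_of_le_add_const K (by simpa using h)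

theorem le_of_forall_pos_le_add_coe {x y : EReal} (h : ∀ η : ℝ, 0 < η → x ≤ y + (η : EReal)) :
    x ≤ y := by
  have ht : Tendsto (fun n : ℕ => y + ((1 / ((n : ℝ) + 1) : ℝ) : EReal)) atTop (𝓝 y) := by
    have h0 : Tendsto (fun n : ℕ => ((1 / ((n : ℝ) + 1) : ℝ) : EReal)) atTop (𝓝 ((0 : ℝ) : EReal)) :=
      (continuous_coe_real_ereal.tendsto 0).comp tendsto_one_div_add_atTop_nhds_zero_nat
    have hc : Tendsto (fun n : ℕ => y + ((1 / ((n : ℝ) + 1) : ℝ) : EReal)) atTop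
        (𝓝 (y + ((0 : ℝ) : EReal))) :=
      (EReal.continuousAt_add (p := (y, ((0 : ℝ) : EReal))) (Or.inr (EReal.coe_ne_bot _))
        (Or.inr (EReal.coe_ne_top _))).tendsto.comp
        ((tendsto_const_nhds (x := y)).prodMk_nhds h0)
    rwa [EReal.coe_zero, add_zero] at hc
  exact ge_of_tendsto' ht fun n => h _ (by positivity)

theorem minSubcover_le {Y : Type*} {C : Set (Set Y)} (D : Finset (Set Y))
    (h : (D : Set (Set Y)) ⊆ C) (h' : ⋃₀ (D : Set (Set Y)) = Set.univ) :
    minSubcover C ≤ D.card :=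
  Nat.sInf_le ⟨D, h, h', rfl⟩

theorem exists_admissible [∀ n, MetricSpace (X n)] [∀ n, CompactSpace (X n)]
    [∀ n, MeasurableSpace (X n)] (μ : ∀ n, Measure (X n)) :
    ∃ P : PartitionSeq X, Admissible μ P := by
  refine ⟨⟨fun _ => 1, fun _ _ => Set.univ, fun _ _ => MeasurableSet.univ, fun n i j hij =>
    absurd (Subsingleton.elim i j) hij,
    fun n => Set.eq_univ_of_forall fun y => Set.mem_iUnion.2 ⟨(0 : Fin 1), trivial⟩⟩,
    ⟨1, by rintro _ ⟨_, rfl⟩; rfl⟩,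
    fun ε _ => ⟨1, one_pos, fun _ _ => Set.univ, fun n i => ⟨isCompact_univ, le_rfl, by simp⟩,
    fun n i j hij => ?_⟩⟩
  exact absurd hij (by rw [Subsingleton.elim (α := Fin 1) i j]; exact lt_irrefl _)

theorem exists_isLebesgueCoverSeq [∀ n, MetricSpace (X n)] :
    ∃ U : ∀ n, Set (Set (X n)), IsLebesgueCoverSeq U :=
  ⟨fun _ => {Set.univ}, fun n V hV => by rw [Set.mem_singleton_iff.1 hV]; exact isOpen_univ,
    fun n => by simp, 1, one_pos, fun n x => ⟨Set.univ, rfl, Set.subset_univ _⟩⟩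

end

end NDS

/-! ### Comparing partitions and covers with words. -/

namespace NSFT

noncomputable section

variable {S : NSFT} {wh vh : ∀ i, Fin (S.l i) → ℝ} {μ : ∀ k, Measure (S.Space k)}

/-- Points of `Σ^i`, `i < n`, that agree up to position `N` have distance less than `δ`. -/
def ResolvesUpTo (S : NSFT) (n N : ℕ) (δ : ℝ) : Prop :=
  ∀ i < n, ∀ y z : S.Space i, S.pref N y = S.pref N z → dist y z < δ

theorem WordsUnbounded.resolvesUpTo (hU : S.WordsUnbounded) {δ : ℝ} (hδ : 0 < δ) (n : ℕ) :
    S.ResolvesUpTo n (S.nTilde δ n) δ := fun i hi _ _ h =>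
  S.dist_lt_of_pref_eq (S.le_nIdx_self δ i) hδ (hU.lt_w_nIdx δ i)
    (S.pref_eq_of_le (S.nIdx_le_nTilde δ hi.le) h)

/-- The compact cores at time `i` are `δ`-separated, so a word resolving distances below `δ` is
compatible with at most one of them. It thus predicts the cell visited at time `i` unless the orbit
misses every core, and `NDS.shannon_le_add_of_approx` bounds the cost of the rare failures. -/
theorem IsParry.joinEntropy_le (hμ : S.IsParry wh vh μ) {P : NDS.PartitionSeq S.Space}
    (hP : NDS.Admissible μ P) {η : ℝ} (hη : 0 < η) :
    ∃ δ : ℝ, 0 < δ ∧ ∀ n N, S.ResolvesUpTo n N δ → NDS.joinEntropy S.shift μ P n ≤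
      NDS.shannon (μ 0) (S.pref N : S.Space 0 → S.Word 0 N) + n * η := by
  classical
  have := hμ.isProbabilityMeasure
  obtain ⟨C₀, hC₀⟩ := hP.card_bdd
  set C := C₀ + 1 with hCdef
  have hC : ∀ n, P.card n ≤ C := fun n => (hC₀ ⟨n, rfl⟩).trans (Nat.le_succ _)
  have hC0 : (0 : ℝ) < C := by positivity
  -- `e` makes `-log (1 - e)` equal to `η / 2`, and `τ` below keeps `τ log (C / e)` under `η / 2`.
  set e := 1 - Real.exp (-(η / 2)) with he
  have hexp : Real.exp (-(η / 2)) < 1 := Real.exp_lt_one_iff.2 (by linarith)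
  have hexp0 := Real.exp_pos (-(η / 2))
  have he0 : 0 < e := by linarith
  have he1 : e < 1 := by linarith
  have hlog1 : -Real.log (1 - e) = η / 2 := by
    rw [he, sub_sub_cancel, Real.log_exp, neg_neg]
  have hlog : 0 ≤ Real.log (C / e) := by
    have : (1 : ℝ) ≤ C := by simp [hCdef]
    exact Real.log_nonneg ((one_le_div he0).2 (he1.le.trans this))
  set τ := η / 2 / (Real.log (C / e) + 1) with hτ
  have hτ0 : 0 < τ := by positivity
  have hτ1 : τ * Real.log (C / e) ≤ η / 2 := by
    rw [hτ, div_mul_eq_mul_div, div_le_iff₀ (by linarith)]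
    nlinarith
  -- With at most `C` cells, a defect `τ / C` per cell gives at most `τ` per time.
  obtain ⟨δ, hδ, K, hK, hsep⟩ := hP.compacts (τ / C) (by positivity)
  refine ⟨δ, hδ, fun n N hN => ?_⟩
  have hsep' : ∀ i a b, a ≠ b → ∀ x ∈ K i a, ∀ y ∈ K i b, δ ≤ dist x y := by
    intro i a b hab x hx y hy
    rcases lt_or_gt_of_ne hab with h | h
    · exact hsep i a b h x hx y hy
    · rw [dist_comm]
      exact hsep i b a h y hy x hx
  obtain ⟨ω₀⟩ : Nonempty (S.Space 0) := nonempty_of_isProbabilityMeasure (μ 0)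
  let Q : ∀ i : Fin n, S.Word 0 N → Fin (P.card i) → Prop := fun i x j =>
    ∃ y : S.Space 0, S.pref N y = x ∧ ∃ z ∈ K i j, S.pref N z = S.pref N (NDS.iter S.shift i y)
  let g : ∀ i : Fin n, S.Word 0 N → Fin (P.card i) := fun i x =>
    if h : ∃ j, Q i x j then h.choose else P.index i (NDS.iter S.shift i ω₀)
  have hgood : ∀ (i : Fin n) (ω : S.Space 0) (j : Fin (P.card i)),
      NDS.iter S.shift i ω ∈ K i j → g i (S.pref N ω) = j := by
    intro i ω j hj
    have hex : ∃ j, Q i (S.pref N ω) j := ⟨j, ω, rfl, _, hj, rfl⟩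
    simp only [g, dif_pos hex]
    obtain ⟨y, hy, z, hz, hzy⟩ := hex.choose_spec
    by_contra hne
    refine absurd (hsep' i _ _ hne z hz _ hj) (not_le.2 (hN i i.2 _ _ ?_))
    rw [hzy]
    exact S.pref_iter_eq hy i
  have hbad : ∀ i : Fin n, (μ 0).real {ω | P.itinerary S.shift n ω i ≠ g i (S.pref N ω)} ≤ τ := by
    intro i
    have hsub : {ω | P.itinerary S.shift n ω i ≠ g i (S.pref N ω)} ⊆
        NDS.iter S.shift i ⁻¹' ⋃ j, P.cell i j \ K i j := by
      intro ω hω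
      refine Set.mem_iUnion.2 ⟨P.index i (NDS.iter S.shift i ω), P.mem_cell_iff.2 rfl, fun hk => ?_⟩
      exact hω (hgood i ω _ hk).symm
    have hmeas : MeasurableSet (⋃ j, P.cell i j \ K i j) :=
      MeasurableSet.iUnion fun j => (P.measurable _ _).diff (hK i j).1.isClosed.measurableSet
    have h1 : (μ 0) {ω | P.itinerary S.shift n ω i ≠ g i (S.pref N ω)} ≤ ENNReal.ofReal τ := by
      calc _ ≤ μ i (⋃ j, P.cell i j \ K i j) := by
            rw [← (hμ.measurePreserving_iter i).measure_preimage hmeas.nullMeasurableSet]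
            exact measure_mono hsub
        _ ≤ ∑ j, μ i (P.cell i j \ K i j) := measure_iUnion_fintype_le _ _
        _ ≤ ∑ j : Fin (P.card i), ENNReal.ofReal (τ / C) := Finset.sum_le_sum fun j _ => (hK i j).2.2
        _ = ENNReal.ofReal (P.card i * (τ / C)) := by
            rw [Finset.sum_const, Finset.card_univ, Fintype.card_fin, nsmul_eq_mul,
              ENNReal.ofReal_mul (Nat.cast_nonneg _), ENNReal.ofReal_natCast]
        _ ≤ ENNReal.ofReal τ := by
            refine ENNReal.ofReal_le_ofReal ?_
            have h2 : (P.card i : ℝ) ≤ C := by exact_mod_cast hC i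
            calc (P.card i : ℝ) * (τ / C) ≤ C * (τ / C) :=
                  mul_le_mul_of_nonneg_right h2 (by positivity)
              _ = τ := by field_simp
    exact ENNReal.toReal_le_of_le_ofReal hτ0.le h1
  rw [NDS.joinEntropy_eq_shannon]
  refine (NDS.shannon_le_add_of_approx (C := C) (fun i => hC i)
    (fun x => S.measurableSet_pref_preimage N {x}) (NDS.measurableSet_itinerary_preimage P
      (fun n => (hμ.measurePreserving_iter n).measurable) n) g he0 he1
      (Nat.succ_pos _) hbad).trans ?_
  have : (n : ℝ) * (-Real.log (1 - e) + τ * Real.log (C / e)) ≤ n * η :=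
    mul_le_mul_of_nonneg_left (by linarith) (Nat.cast_nonneg n)
  linarith

/-- One representative per word suffices: the Lebesgue balls around its iterates contain the
iterates of every sequence with the same word. -/
theorem minSubcover_joinCover_le {U : ∀ n, Set (Set (S.Space n))}
    (hU : NDS.IsLebesgueCoverSeq U) : ∃ δ : ℝ, 0 < δ ∧ ∀ n N, S.ResolvesUpTo n N δ →
      NDS.minSubcover (NDS.joinCover S.shift U n) ≤ S.w 0 N := by
  classical
  obtain ⟨δ, hδ, hb⟩ := hU.lebesgue
  choose V hVU hV using hb
  refine ⟨δ, hδ, fun n N hN => ?_⟩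
  rcases isEmpty_or_nonempty (S.Space 0) with hempty | hne
  · exact (NDS.minSubcover_le ∅ (by simp) (Subsingleton.elim _ _)).trans (Nat.zero_le _)
  let A : S.Space 0 → Set (S.Space 0) := fun y =>
    ⋂ i < n, NDS.iter S.shift i ⁻¹' V i (NDS.iter S.shift i y)
  have hex : ∀ x ∈ Set.range (S.pref N : S.Space 0 → S.Word 0 N), ∃ y, S.pref N y = x := by
    rintro _ ⟨y, rfl⟩
    exact ⟨y, rfl⟩
  choose! p hp using hex
  have hfin : (Set.range (S.pref N : S.Space 0 → S.Word 0 N)).Finite := Set.toFinite _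
  refine (NDS.minSubcover_le (hfin.toFinset.image fun x => A (p x)) ?_ ?_).trans ?_
  · intro B hB
    obtain ⟨x, _, rfl⟩ := Finset.mem_image.1 (Finset.mem_coe.1 hB)
    exact ⟨fun i => V i (NDS.iter S.shift i (p x)), fun i _ => hVU _ _, rfl⟩
  · refine Set.eq_univ_of_forall fun y => Set.mem_sUnion.2 ⟨A (p (S.pref N y)), ?_, ?_⟩
    · exact Finset.mem_coe.2 (Finset.mem_image_of_mem _ (hfin.mem_toFinset.2 ⟨y, rfl⟩))
    · refine Set.mem_iInter₂.2 fun i hi => hV _ _ ?_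
      exact hN i hi _ _ (S.pref_iter_eq (hp _ ⟨y, rfl⟩).symm i)
  · refine Finset.card_image_le.trans ?_
    rw [w_eq_card]
    refine Finset.card_le_card fun x hx => ?_
    rw [Set.Finite.mem_toFinset] at hx ⊢
    obtain ⟨y, rfl⟩ := hx
    exact S.pref_mem_admWords N y

/-- The windows `[i, n_i(ε)]`, `i ≤ n`, cover `[0, ñ_n(ε)]`: a position `j ≤ n` lies in its own
window, and positions beyond `n` lie in the window that attains the maximum. -/
theorem pref_eq_of_forall_pref_iter_eq {ε : ℝ} {n : ℕ} {y z : S.Space 0}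
    (h : ∀ i ≤ n, S.pref (S.nIdx ε i) (NDS.iter S.shift i y) =
      S.pref (S.nIdx ε i) (NDS.iter S.shift i z)) :
    S.pref (S.nTilde ε n) y = S.pref (S.nTilde ε n) z := by
  have key : ∀ i ≤ n, ∀ j, i ≤ j → j ≤ S.nIdx ε i →
      y.seq ⟨j, Nat.zero_le j⟩ = z.seq ⟨j, Nat.zero_le j⟩ := by
    intro i hi j hij hj
    have := S.pref_eq_iff.1 (h i hi) j hij hj
    rwa [iter_shift_seq, iter_shift_seq] at this
  rw [pref_eq_iff]
  intro j _ hj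
  rcases le_total j n with hjn | hjn
  · exact key j hjn j le_rfl (S.le_nIdx_self ε j)
  · obtain ⟨i, hi, he⟩ := S.exists_nTilde_eq ε n
    exact key i hi j (hi.trans hjn) (he ▸ hj)

/-- The partitions of `Σ^n` into the cylinders of the words `(x_n, …, x_{n_n(ε)})`. -/
def cylinderPartition (S : NSFT) (ε : ℝ) : NDS.PartitionSeq S.Space where
  card n := Nat.card (S.admWords n (S.nIdx ε n))
  cell n i := S.pref (S.nIdx ε n) ⁻¹' {((Finite.equivFin _).symm i).1}
  measurable n i := S.measurableSet_pref_preimage _ _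
  disjoint n i j hij := by
    refine Set.disjoint_left.2 fun y (hi : _ = _) (hj : _ = _) => hij ?_
    exact (Finite.equivFin _).symm.injective (Subtype.ext (hi.symm.trans hj))
  cover n := by
    refine Set.eq_univ_of_forall fun y => Set.mem_iUnion.2
      ⟨Finite.equivFin _ ⟨_, S.pref_mem_admWords (S.nIdx ε n) y⟩, ?_⟩
    rw [Equiv.symm_apply_apply]
    rfl

/-- The cells are clopen, so they serve as their own compact cores. By `w_nIdx_le` their number and
the inverse of their mutual distance are bounded uniformly in `n`. -/
theorem admissible_cylinderPartition {ε : ℝ} (hε : 0 < ε) :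
    NDS.Admissible μ (S.cylinderPartition ε) := by
  have hl : (1 : ℝ) ≤ S.lMax := by exact_mod_cast S.lMax_pos
  set W : ℝ := S.lMax * (1 + 1 / ε) with hW
  have hW0 : 0 < W := by positivity
  have hw : ∀ n, (S.w n (S.nIdx ε n) : ℝ) ≤ W := S.w_nIdx_le hε
  refine ⟨⟨⌊W⌋₊, ?_⟩, fun ε' _ => ⟨W⁻¹, inv_pos.2 hW0, (S.cylinderPartition ε).cell,
    fun n i => ⟨(S.isClosed_pref_preimage _ _).isCompact, le_rfl, by simp⟩, ?_⟩⟩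
  · rintro _ ⟨n, rfl⟩
    refine Nat.le_floor ?_
    have : (S.cylinderPartition ε).card n = S.w n (S.nIdx ε n) := Nat.card_coe_set_eq _
    rw [this]
    exact hw n
  · intro n i j hij x hx y hy
    by_contra hlt
    have hwpos : (0 : ℝ) < S.w n (S.nIdx ε n) := by exact_mod_cast S.w_pos x _
    have h1 := S.pref_eq_of_dist_lt ((not_le.1 hlt).trans_le (inv_anti₀ hwpos (hw n)))
    have hx' : S.pref _ x = ((Finite.equivFin _).symm i).1 := hx
    have hy' : S.pref _ y = ((Finite.equivFin _).symm j).1 := hy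
    refine hij.ne ((Finite.equivFin _).symm.injective (Subtype.ext ?_))
    rw [← hx', h1, hy']

theorem IsParry.shannon_le_joinEntropy (hμ : S.IsParry wh vh μ) (ε : ℝ) (n : ℕ) :
    NDS.shannon (μ 0) (S.pref (S.nTilde ε n) : S.Space 0 → S.Word 0 (S.nTilde ε n)) ≤
      NDS.joinEntropy S.shift μ (S.cylinderPartition ε) (n + 1) := by
  have := hμ.isProbabilityMeasure 0
  have : Nonempty (S.Word 0 (S.nTilde ε n)) := ⟨fun i => ⟨0, S.l_pos i⟩⟩
  rw [NDS.joinEntropy_eq_shannon]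
  refine NDS.shannon_le_of_factor (NDS.measurableSet_itinerary_preimage _
    (fun n => (hμ.measurePreserving_iter n).measurable) _) fun y z h => ?_
  refine pref_eq_of_forall_pref_iter_eq fun i hi => ?_
  have h1 := congrFun h ⟨i, Nat.lt_succ_of_le hi⟩
  have hy := (S.cylinderPartition ε).mem_cell_iff.2 (rfl : (S.cylinderPartition ε).index i
    (NDS.iter S.shift i y) = _)
  have hz := (S.cylinderPartition ε).mem_cell_iff.2 h1.symm
  exact Eq.trans hy (Eq.symm hz)

theorem isLebesgueCoverSeq_cylinders {ε : ℝ} (hε : 0 < ε) :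
    NDS.IsLebesgueCoverSeq fun n => Set.range fun x : S.Word n (S.nIdx ε n) =>
      (S.pref (S.nIdx ε n) ⁻¹' {x} : Set (S.Space n)) := by
  have hl : (1 : ℝ) ≤ S.lMax := by exact_mod_cast S.lMax_pos
  have hW0 : 0 < S.lMax * (1 + 1 / ε) := by positivity
  refine ⟨?_, ?_, ⟨(S.lMax * (1 + 1 / ε))⁻¹, inv_pos.2 hW0, ?_⟩⟩
  · rintro n _ ⟨x, rfl⟩
    exact S.isOpen_pref_preimage _ _
  · exact fun n => Set.eq_univ_of_forall fun y => ⟨_, ⟨S.pref _ y, rfl⟩, rfl⟩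
  · refine fun n y => ⟨_, ⟨S.pref _ y, rfl⟩, fun z hz => ?_⟩
    have hwpos : (0 : ℝ) < S.w n (S.nIdx ε n) := by exact_mod_cast S.w_pos y _
    exact S.pref_eq_of_dist_lt ((Metric.mem_ball.1 hz).trans_le
      (inv_anti₀ hwpos (S.w_nIdx_le hε n)))

/-- Each element of the join contains at most one word up to `ñ_n(ε)`, while every admissible word
occurs in some sequence. -/
theorem IsParry.w_le_minSubcover (hμ : S.IsParry wh vh μ) (ε : ℝ) (n : ℕ) :
    S.w 0 (S.nTilde ε n) ≤ NDS.minSubcover (NDS.joinCover S.shift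
      (fun n => Set.range fun x : S.Word n (S.nIdx ε n) =>
        (S.pref (S.nIdx ε n) ⁻¹' {x} : Set (S.Space n))) (n + 1)) := by
  classical
  set C := NDS.joinCover S.shift (fun n => Set.range fun x : S.Word n (S.nIdx ε n) =>
        (S.pref (S.nIdx ε n) ⁻¹' {x} : Set (S.Space n))) (n + 1) with hC
  have hpref : ∀ A ∈ C, ∀ y ∈ A, ∀ z ∈ A,
      S.pref (S.nTilde ε n) y = S.pref (S.nTilde ε n) z := by
    rintro _ ⟨V, hV, rfl⟩ y hy z hz
    refine pref_eq_of_forall_pref_iter_eq fun i hi => ?_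
    obtain ⟨x, hx⟩ := hV i (Nat.lt_succ_of_le hi)
    have hy' := Set.mem_iInter₂.1 hy i (Nat.lt_succ_of_le hi)
    have hz' := Set.mem_iInter₂.1 hz i (Nat.lt_succ_of_le hi)
    rw [← hx] at hy' hz'
    exact Eq.trans hy' (Eq.symm hz')
  refine le_csInf ?_ ?_
  -- A finite subcover has to be exhibited, since the infimum of the empty set of naturals is `0`.
  · let A : (∀ i : Fin (n + 1), S.Word i (S.nIdx ε i)) → Set (S.Space 0) := fun x =>
      ⋂ i, ⋂ h : i < n + 1, NDS.iter S.shift i ⁻¹' (S.pref (S.nIdx ε i) ⁻¹' {x ⟨i, h⟩})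
    refine ⟨_, Finset.univ.image A, ?_, ?_, rfl⟩
    · intro B hB
      obtain ⟨x, _, rfl⟩ := Finset.mem_image.1 (Finset.mem_coe.1 hB)
      refine ⟨fun i => if h : i < n + 1 then S.pref (S.nIdx ε i) ⁻¹' {x ⟨i, h⟩} else ∅,
        fun i hi => ?_, ?_⟩
      · simp only [dif_pos hi]
        exact ⟨_, rfl⟩
      · refine Set.iInter_congr fun i => Set.iInter_congr fun hi => ?_
        simp only [dif_pos hi]
    · refine Set.eq_univ_of_forall fun y => Set.mem_sUnion.2
        ⟨A fun i => S.pref _ (NDS.iter S.shift i y), by simp, ?_⟩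
      exact Set.mem_iInter₂.2 fun i hi => rfl
  · rintro _ ⟨D, hD, hcov, rfl⟩
    have hex : ∀ x ∈ S.admWords 0 (S.nTilde ε n), ∃ A ∈ D, ∃ y ∈ A, S.pref (S.nTilde ε n) y = x := by
      intro x hx
      obtain ⟨y, hy⟩ := hμ.exists_pref_iter_eq (Nat.zero_le _) hx
      obtain ⟨A, hA, hyA⟩ := Set.mem_sUnion.1 (hcov.symm ▸ Set.mem_univ y)
      exact ⟨A, hA, y, hyA, hy⟩
    choose! f hfD p hpf hp using hex
    rw [w, ← Set.ncard_coe_finset]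
    refine Set.ncard_le_ncard_of_injOn f (fun x hx => hfD x hx) ?_ (Set.toFinite _)
    intro x hx x' hx' hxx
    rw [← hp x hx, ← hp x' hx']
    exact hpref (f x) (hD (hfD x hx)) _ (hpf x hx) _ (hxx ▸ hpf x' hx')

theorem IsParry.shannon_pref_mono (hμ : S.IsParry wh vh μ) {m n : ℕ} (h : m ≤ n) :
    NDS.shannon (μ 0) (S.pref m : S.Space 0 → S.Word 0 m) ≤
      NDS.shannon (μ 0) (S.pref n : S.Space 0 → S.Word 0 n) := by
  have := hμ.isProbabilityMeasure 0
  have : Nonempty (S.Word 0 m) := ⟨fun i => ⟨0, S.l_pos i⟩⟩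
  exact NDS.shannon_le_of_factor (fun x => S.measurableSet_pref_preimage n {x})
    fun y z hyz => S.pref_eq_of_le h hyz

theorem IsParry.shannon_pref_le_log (hμ : S.IsParry wh vh μ) (n : ℕ) :
    NDS.shannon (μ 0) (S.pref n : S.Space 0 → S.Word 0 n) ≤ Real.log (S.w 0 n) := by
  have := hμ.isProbabilityMeasure 0
  rw [w_eq_card]
  exact NDS.shannon_le_log_card (fun x => S.measurableSet_pref_preimage n {x}) _
    fun y => by simpa using S.pref_mem_admWords n y

/-- Each step from `k` to `k + 1` adds at most one window, with boundedly many words, starting no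
later than `ñ_k(ε) + 1`. So `log w(0, ñ_k(ε))` grows at most linearly. -/
theorem w_nTilde_le {ε : ℝ} (hε : 0 < ε) (k : ℕ) :
    (S.w 0 (S.nTilde ε k) : ℝ) ≤ (S.lMax * (1 + 1 / ε)) ^ (k + 1) := by
  have hl : (1 : ℝ) ≤ S.lMax := by exact_mod_cast S.lMax_pos
  have he : 0 < 1 / ε := one_div_pos.2 hε
  have hW1 : 1 ≤ S.lMax * (1 + 1 / ε) := by nlinarith
  induction k with
  | zero =>
    have : S.nTilde ε 0 = S.nIdx ε 0 := by simp [nTilde, nIdx]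
    rw [this, zero_add, pow_one]
    exact S.w_nIdx_le hε 0
  | succ k ih =>
    have hmax : S.nTilde ε (k + 1) = max (S.nIdx ε (k + 1)) (S.nTilde ε k) := by
      rw [nTilde, Finset.range_add_one, Finset.sup_insert]
      rfl
    rw [hmax, pow_succ]
    rcases le_total (S.nIdx ε (k + 1)) (S.nTilde ε k) with h | h
    · rw [max_eq_right h]
      exact ih.trans (le_mul_of_one_le_right (by positivity) hW1)
    · rw [max_eq_left h]
      have h2 : S.w 0 (S.nIdx ε (k + 1)) ≤
          S.w 0 (S.nTilde ε k) * S.w (k + 1) (S.nIdx ε (k + 1)) :=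
        S.w_le_mul (Nat.zero_le _) (Nat.succ_le_succ (S.le_nTilde ε k)) h
      have h3 : (S.w 0 (S.nIdx ε (k + 1)) : ℝ) ≤
          S.w 0 (S.nTilde ε k) * S.w (k + 1) (S.nIdx ε (k + 1)) := by exact_mod_cast h2
      exact h3.trans (mul_le_mul ih (S.w_nIdx_le hε _) (Nat.cast_nonneg _) (by positivity))

theorem exists_w_le_of_not_wordsUnbounded (hU : ¬ S.WordsUnbounded) :
    ∃ B : ℕ, ∀ n, S.w 0 n ≤ B := by
  unfold WordsUnbounded at hU
  push Not at hU
  obtain ⟨k, B, hB⟩ := hU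
  refine ⟨S.w 0 k * ⌊B⌋₊, fun n => (S.w_mono (Nat.zero_le n) (Nat.le_add_left n k)).trans ?_⟩
  exact (S.w_le_mul (Nat.zero_le k) (Nat.le_succ k) (Nat.le_add_right k n)).trans
    (Nat.mul_le_mul_left _ (Nat.le_floor (hB n)))

theorem IsParry.meanLogColSum_nonneg (hμ : S.IsParry wh vh μ) (n : ℕ) :
    0 ≤ S.meanLogColSum wh vh n :=
  Finset.sum_nonneg fun b _ => mul_nonneg (hμ.parryVec_pos n b).le
    (Real.log_nonneg (one_le_colSum n b))

theorem IsParry.exists_meanLogColSum_le (hμ : S.IsParry wh vh μ) {B : ℕ}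
    (hB : ∀ n, S.w 0 n ≤ B) : ∃ K : ℝ, ∀ n, S.meanLogColSum wh vh n ≤ K := by
  obtain ⟨K, hK, h⟩ := hμ.exists_colSum_w
  refine ⟨Real.log (K * B), fun n => ?_⟩
  calc _ ≤ ∑ b, S.parryVec wh vh n b * Real.log (K * B) := by
        refine Finset.sum_le_sum fun b _ => mul_le_mul_of_nonneg_left ?_ (hμ.parryVec_pos n b).le
        refine Real.log_le_log (zero_lt_one.trans_le (one_le_colSum n b)) (((h n).1 b).trans ?_)
        exact mul_le_mul_of_nonneg_left (by exact_mod_cast hB n) (by linarith)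
    _ = _ := by rw [← Finset.sum_mul, hμ.sum_parryVec, one_mul]

theorem IsParry.metricEntropy_nonneg (hμ : S.IsParry wh vh μ) :
    0 ≤ NDS.metricEntropy S.shift μ := by
  have := hμ.isProbabilityMeasure 0
  obtain ⟨P, hP⟩ := NDS.exists_admissible μ
  refine le_trans ?_ (le_iSup₂ (f := fun P _ => NDS.partitionEntropy S.shift μ P) P hP)
  refine NDS.limsup_div_nonneg fun n => ?_
  rw [NDS.joinEntropy_eq_shannon]
  exact NDS.shannon_nonneg

theorem topEntropy_nonneg : 0 ≤ NDS.topEntropy S.shift := by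
  obtain ⟨U, hU⟩ := NDS.exists_isLebesgueCoverSeq (X := S.Space)
  refine le_trans ?_ (le_iSup₂ (f := fun U _ => NDS.coverEntropy S.shift U) U hU)
  exact NDS.limsup_div_nonneg fun n => Real.log_natCast_nonneg _

theorem IsParry.metricEntropy_eq_zero (hμ : S.IsParry wh vh μ) [Finite (S.Space 0)] :
    NDS.metricEntropy S.shift μ = 0 := by
  have := hμ.isProbabilityMeasure 0
  have := Fintype.ofFinite (S.Space 0)
  obtain ⟨ω₀⟩ : Nonempty (S.Space 0) := nonempty_of_isProbabilityMeasure (μ 0)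
  refine le_antisymm (iSup₂_le fun P _ => ?_) hμ.metricEntropy_nonneg
  refine NDS.limsup_div_nonpos (NDS.shannon (μ 0) (id : S.Space 0 → S.Space 0)) fun n => ?_
  have : Nonempty (∀ i : Fin n, Fin (P.card i)) := ⟨P.itinerary S.shift n ω₀⟩
  rw [NDS.joinEntropy_eq_shannon]
  exact NDS.shannon_le_of_factor (fun y => measurableSet_singleton y)
    fun y z (h : y = z) => by rw [h]

theorem topEntropy_eq_zero [Finite (S.Space 0)] : NDS.topEntropy S.shift = 0 := by
  classical
  have := Fintype.ofFinite (S.Space 0)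
  refine le_antisymm (iSup₂_le fun U hU => ?_) topEntropy_nonneg
  refine NDS.limsup_div_nonpos (Real.log (Fintype.card (S.Space 0))) fun n => ?_
  have hV : ∀ i (y : S.Space i), ∃ V ∈ U i, y ∈ V := fun i y =>
    Set.mem_sUnion.1 ((hU.cover i).symm ▸ Set.mem_univ y)
  choose V hVU hyV using hV
  have hle : NDS.minSubcover (NDS.joinCover S.shift U n) ≤ Fintype.card (S.Space 0) := by
    refine (NDS.minSubcover_le (Finset.univ.image fun y : S.Space 0 =>
      ⋂ i < n, NDS.iter S.shift i ⁻¹' V i (NDS.iter S.shift i y)) ?_ ?_).trans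
        Finset.card_image_le
    · intro A hA
      obtain ⟨y, _, rfl⟩ := Finset.mem_image.1 (Finset.mem_coe.1 hA)
      exact ⟨fun i => V i (NDS.iter S.shift i y), fun i _ => hVU _ _, rfl⟩
    · refine Set.eq_univ_of_forall fun y => Set.mem_sUnion.2 ⟨_,
        Finset.mem_coe.2 (Finset.mem_image_of_mem _ (Finset.mem_univ y)), ?_⟩
      exact Set.mem_iInter₂.2 fun i _ => hyV _ _
  rcases Nat.eq_zero_or_pos (NDS.minSubcover (NDS.joinCover S.shift U n)) with h0 | h0
  · rw [h0]
    simpa using Real.log_natCast_nonneg _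
  · exact Real.log_le_log (by exact_mod_cast h0) (by exact_mod_cast hle)

/-! ### Growth rates of words, and the two entropies. -/

/-- The growth rate of the entropies of the words `(x_0, …, x_{ñ_k(ε)})`. -/
def wordEntropy (S : NSFT) (μ : ∀ k, Measure (S.Space k)) (ε : ℝ) : EReal :=
  limsup (fun k : ℕ => ((1 / (k : ℝ) * NDS.shannon (μ 0)
    (S.pref (S.nTilde ε k) : S.Space 0 → S.Word 0 (S.nTilde ε k)) : ℝ) : EReal)) atTop

theorem IsParry.limsup_meanLogColSum_eq (hμ : S.IsParry wh vh μ) (ε : ℝ) :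
    limsup (fun k : ℕ => ((1 / (k : ℝ) * S.meanLogColSum wh vh (S.nTilde ε k) : ℝ) : EReal)) atTop =
      S.wordEntropy μ ε := by
  obtain ⟨K, hK⟩ := hμ.exists_abs_shannon_sub_le
  refine le_antisymm (NDS.limsup_div_le_of_le_add_const K fun k => ?_)
    (NDS.limsup_div_le_of_le_add_const K fun k => ?_)
  · linarith [(abs_le.1 (hK (S.nTilde ε k))).1]
  · linarith [(abs_le.1 (hK (S.nTilde ε k))).2]

theorem IsParry.wordEntropy_anti (hμ : S.IsParry wh vh μ) (hU : S.WordsUnbounded) {ε ε' : ℝ}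
    (hε : 0 < ε') (h : ε' ≤ ε) : S.wordEntropy μ ε ≤ S.wordEntropy μ ε' :=
  NDS.limsup_div_le_of_eventually_le (Eventually.of_forall fun k =>
    hμ.shannon_pref_mono (hU.nTilde_anti hε h k))

theorem IsParry.wordEntropy_le_metricEntropy (hμ : S.IsParry wh vh μ) (hU : S.WordsUnbounded)
    {ε : ℝ} (hε : 0 < ε) : S.wordEntropy μ ε ≤ NDS.metricEntropy S.shift μ := by
  obtain ⟨ε', hε', h⟩ := hU.exists_nTilde_succ_le hε
  refine le_trans ?_ (le_iSup₂ (f := fun P _ => NDS.partitionEntropy S.shift μ P)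
    (S.cylinderPartition ε') (admissible_cylinderPartition hε'))
  refine NDS.limsup_div_le_of_eventually_le ?_
  filter_upwards [eventually_ge_atTop 1] with n hn
  obtain ⟨k, rfl⟩ := Nat.exists_eq_add_of_le' hn
  exact (hμ.shannon_pref_mono (h k)).trans (hμ.shannon_le_joinEntropy ε' k)

theorem IsParry.metricEntropy_le (hμ : S.IsParry wh vh μ) (hU : S.WordsUnbounded) :
    NDS.metricEntropy S.shift μ ≤ ⨆ (ε : ℝ) (_ : 0 < ε), S.wordEntropy μ ε := by
  refine iSup₂_le fun P hP => NDS.le_of_forall_pos_le_add_coe fun η hη => ?_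
  obtain ⟨δ, hδ, h⟩ := hμ.joinEntropy_le hP hη
  refine le_trans ?_ (add_le_add_left
    (le_iSup₂ (f := fun ε (_ : 0 < ε) => S.wordEntropy μ ε) δ hδ) _)
  refine NDS.limsup_div_le 0 η (Eventually.of_forall fun n => ?_)
  rw [add_zero]
  exact h n _ (hU.resolvesUpTo hδ n)

/-- The growth rate increases as `ε` decreases, so its supremum, the metric entropy, is its limit.
-/
theorem IsParry.tendsto_wordEntropy (hμ : S.IsParry wh vh μ) (hU : S.WordsUnbounded) :
    Tendsto (S.wordEntropy μ) (𝓝[>] 0) (𝓝 (NDS.metricEntropy S.shift μ)) := by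
  refine tendsto_order.2 ⟨fun a ha => ?_, fun a ha => ?_⟩
  · obtain ⟨ε₀, hε₀⟩ := lt_iSup_iff.1 (ha.trans_le (hμ.metricEntropy_le hU))
    obtain ⟨hpos, h⟩ := lt_iSup_iff.1 hε₀
    filter_upwards [Ioc_mem_nhdsGT hpos] with ε hε
    exact h.trans_le (hμ.wordEntropy_anti hU hε.1 hε.2)
  · filter_upwards [self_mem_nhdsWithin] with ε hε
    exact (hμ.wordEntropy_le_metricEntropy hU hε).trans_lt ha

/-- The growth rate of the numbers of words `(x_0, …, x_{ñ_k(ε)})`. -/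
def wordGrowth (S : NSFT) (ε : ℝ) : EReal :=
  limsup (fun k : ℕ => ((1 / (k : ℝ) * Real.log (S.w 0 (S.nTilde ε k)) : ℝ) : EReal)) atTop

theorem IsParry.w_zero_pos (hμ : S.IsParry wh vh μ) (n : ℕ) : 0 < S.w 0 n := by
  have := hμ.isProbabilityMeasure 0
  obtain ⟨y⟩ : Nonempty (S.Space 0) := nonempty_of_isProbabilityMeasure (μ 0)
  exact S.w_pos y n

theorem topEntropy_le (hU : S.WordsUnbounded) :
    NDS.topEntropy S.shift ≤ ⨆ (ε : ℝ) (_ : 0 < ε), S.wordGrowth ε := by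
  refine iSup₂_le fun U hcov => ?_
  obtain ⟨δ, hδ, h⟩ := minSubcover_joinCover_le hcov
  refine le_trans ?_ (le_iSup₂ (f := fun ε (_ : 0 < ε) => S.wordGrowth ε) δ hδ)
  refine NDS.limsup_div_le_of_eventually_le (Eventually.of_forall fun n => ?_)
  have hle := h n _ (hU.resolvesUpTo hδ n)
  rcases Nat.eq_zero_or_pos (NDS.minSubcover (NDS.joinCover S.shift U n)) with h0 | h0
  · rw [h0]
    simpa using Real.log_natCast_nonneg _
  · exact Real.log_le_log (by exact_mod_cast h0) (by exact_mod_cast hle)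

theorem IsParry.wordGrowth_le_topEntropy (hμ : S.IsParry wh vh μ) (hU : S.WordsUnbounded)
    {ε : ℝ} (hε : 0 < ε) : S.wordGrowth ε ≤ NDS.topEntropy S.shift := by
  obtain ⟨ε', hε', h⟩ := hU.exists_nTilde_succ_le hε
  refine le_trans ?_ (le_iSup₂ (f := fun U _ => NDS.coverEntropy S.shift U) _
    (isLebesgueCoverSeq_cylinders hε'))
  refine NDS.limsup_div_le_of_eventually_le ?_
  filter_upwards [eventually_ge_atTop 1] with n hn
  obtain ⟨k, rfl⟩ := Nat.exists_eq_add_of_le' hn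
  refine Real.log_le_log (by exact_mod_cast hμ.w_zero_pos _) ?_
  exact_mod_cast (S.w_mono (Nat.zero_le _) (h k)).trans (hμ.w_le_minSubcover ε' k)

theorem IsParry.metricEntropy_le_topEntropy (hμ : S.IsParry wh vh μ) (hU : S.WordsUnbounded) :
    NDS.metricEntropy S.shift μ ≤ NDS.topEntropy S.shift := by
  refine (hμ.metricEntropy_le hU).trans (iSup₂_le fun ε hε => ?_)
  refine le_trans ?_ (hμ.wordGrowth_le_topEntropy hU hε)
  exact NDS.limsup_div_le_of_eventually_le (Eventually.of_forall fun k => hμ.shannon_pref_le_log _)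

/-- Letters that maximize the column sums of `L^{(0,k)}` are followed by most letters at time
`n_k(ε)`. -/
def MaximizersSpread (S : NSFT) (wh vh : ∀ i, Fin (S.l i) → ℝ) (δ ε : ℝ) (k₀ : ℕ) : Prop :=
  ∀ k ≥ k₀, ∀ γ : Fin (S.l k), S.Maximizes k γ →
    ∃ B : Finset (Fin (S.l (S.nIdx ε k))),
      (∀ β ∈ B, 1 ≤ S.matProd (Nat.le_add_right k (S.mIdx ε k)) γ β) ∧
      1 - δ ≤ ∑ β ∈ B, S.parryVec wh vh (S.nIdx ε k) β

/-- The core of (ii). The largest column sum is at least `w(0,k)` divided by `K * lMax`. A letter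
`β` reachable from the maximizer `γ` has a column sum at least as large as that of `γ`, and such
letters have mass at least `1 - δ`. The constant depends on neither `δ` nor `ε`. -/
theorem IsParry.exists_log_w_le (hμ : S.IsParry wh vh μ) :
    ∃ K : ℝ, ∀ δ ε : ℝ, 0 < δ → δ < 1 → ∀ k₀, S.MaximizersSpread wh vh δ ε k₀ → ∀ k ≥ k₀,
      (1 - δ) * Real.log (S.w 0 k) ≤ S.meanLogColSum wh vh (S.nIdx ε k) + K := by
  obtain ⟨K, hK, h⟩ := hμ.exists_colSum_w
  have hl : (1 : ℝ) ≤ S.lMax := by exact_mod_cast S.lMax_pos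
  refine ⟨Real.log (K * S.lMax), fun δ ε hδ hδ1 k₀ hspread k hk => ?_⟩
  have : Nonempty (Fin (S.l k)) := ⟨⟨0, S.l_pos k⟩⟩
  obtain ⟨γ, hγ⟩ := Finite.exists_max (S.colSum k)
  obtain ⟨B, hB, hBδ⟩ := hspread k hk γ hγ
  have hγ1 := one_le_colSum k γ
  have hw0 : (0 : ℝ) < S.w 0 k := by exact_mod_cast hμ.w_zero_pos k
  have hKl : 1 ≤ K * S.lMax := by nlinarith
  have hw : (S.w 0 k : ℝ) ≤ K * S.lMax * S.colSum k γ := by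
    calc (S.w 0 k : ℝ) ≤ K * ∑ b, S.colSum k b := (h k).2
      _ ≤ K * ∑ _b : Fin (S.l k), S.colSum k γ :=
        mul_le_mul_of_nonneg_left (Finset.sum_le_sum fun b _ => hγ b) (by linarith)
      _ = K * (S.l k * S.colSum k γ) := by simp
      _ ≤ K * (S.lMax * S.colSum k γ) := by
        have : (S.l k : ℝ) ≤ S.lMax := by exact_mod_cast S.l_le_lMax k
        gcongr
      _ = _ := by ring
  have hlogw : Real.log (S.w 0 k) ≤ Real.log (K * S.lMax) + Real.log (S.colSum k γ) := by
    rw [← Real.log_mul (by positivity) (by positivity)]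
    exact Real.log_le_log hw0 hw
  have hlγ := Real.log_nonneg hγ1
  have hlK := Real.log_nonneg hKl
  have hmean : (1 - δ) * Real.log (S.colSum k γ) ≤ S.meanLogColSum wh vh (S.nIdx ε k) := by
    calc _ ≤ (∑ β ∈ B, S.parryVec wh vh (S.nIdx ε k) β) * Real.log (S.colSum k γ) :=
          mul_le_mul_of_nonneg_right hBδ hlγ
      _ ≤ ∑ β ∈ B, S.parryVec wh vh (S.nIdx ε k) β * Real.log (S.colSum (S.nIdx ε k) β) := by
          rw [Finset.sum_mul]
          refine Finset.sum_le_sum fun β hβ =>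
            mul_le_mul_of_nonneg_left ?_ (hμ.parryVec_pos _ β).le
          refine Real.log_le_log (by linarith) ?_
          refine le_trans ?_ (colSum_mul_le (Nat.le_add_right k (S.mIdx ε k)) γ β)
          exact le_mul_of_one_le_right (by linarith) (hB β hβ)
      _ ≤ _ := Finset.sum_le_sum_of_subset_of_nonneg (Finset.subset_univ _) fun β _ _ =>
          mul_nonneg (hμ.parryVec_pos _ β).le (Real.log_nonneg (one_le_colSum _ β))
  have h1 := mul_le_mul_of_nonneg_left hlogw (by linarith : 0 ≤ 1 - δ)
  nlinarith

/-- `exists_log_w_le` is applied at time `ñ_k(ε')`; the entropy then appears at time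
`n_{ñ_k(ε')}(ε)`, which is at most `ñ_k(ε'')` for a suitable `ε''`. -/
theorem IsParry.wordGrowth_le_metricEntropy (hμ : S.IsParry wh vh μ) (hU : S.WordsUnbounded)
    (hs : ∀ δ ∈ Set.Ioo (0 : ℝ) 1, ∃ ε : ℝ, 0 < ε ∧ ∃ k₀ : ℕ, S.MaximizersSpread wh vh δ ε k₀)
    {ε' : ℝ} (hε' : 0 < ε') : S.wordGrowth ε' ≤ NDS.metricEntropy S.shift μ := by
  refine NDS.le_of_forall_pos_le_add_coe fun η hη => ?_
  obtain ⟨K, hK⟩ := hμ.exists_log_w_le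
  obtain ⟨K', hK'⟩ := hμ.exists_abs_shannon_sub_le
  have hl : (1 : ℝ) ≤ S.lMax := by exact_mod_cast S.lMax_pos
  have he : 0 < 1 / ε' := one_div_pos.2 hε'
  have hW1 : 1 ≤ S.lMax * (1 + 1 / ε') := by nlinarith
  set D := Real.log (S.lMax * (1 + 1 / ε')) with hD
  have hD0 : 0 ≤ D := Real.log_nonneg hW1
  have hlogw : ∀ k, Real.log (S.w 0 (S.nTilde ε' k)) ≤ (k + 1) * D := by
    intro k
    have := Real.log_le_log (by exact_mod_cast hμ.w_zero_pos _) (w_nTilde_le (S := S) hε' k)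
    rwa [Real.log_pow, Nat.cast_add, Nat.cast_one] at this
  -- The lost part `δ log w(0, ñ_k(ε'))` is at most `δ (k + 1) D`, hence at most `(k + 1) η`.
  obtain ⟨δ, hδ0, hδ1, hδD⟩ : ∃ δ : ℝ, 0 < δ ∧ δ < 1 ∧ δ * D ≤ η := by
    refine ⟨min (1 / 2) (η / (D + 1)), by positivity, (min_le_left _ _).trans_lt (by norm_num), ?_⟩
    calc _ ≤ η / (D + 1) * D := mul_le_mul_of_nonneg_right (min_le_right _ _) hD0
      _ ≤ η := by
        rw [div_mul_eq_mul_div, div_le_iff₀ (by linarith)]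
        nlinarith
  obtain ⟨ε, hε, k₀, hspread⟩ := hs δ ⟨hδ0, hδ1⟩
  obtain ⟨ε'', hε'', hn⟩ := hU.exists_nIdx_nTilde_le hε hε'
  refine le_trans ?_ (add_le_add_left (hμ.wordEntropy_le_metricEntropy hU hε'') _)
  -- The constant `η` is the excess of `(k + 1) η` over `k η`.
  refine NDS.limsup_div_le (K + K' + η) η ?_
  filter_upwards [eventually_ge_atTop k₀] with k hk
  have h1 := hK δ ε hδ0 hδ1 k₀ hspread (S.nTilde ε' k) (hk.trans (S.le_nTilde ε' k))
  have h2 := (abs_le.1 (hK' (S.nIdx ε (S.nTilde ε' k)))).1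
  have h3 := hμ.shannon_pref_mono (hn k)
  have h4 : δ * Real.log (S.w 0 (S.nTilde ε' k)) ≤ (k + 1) * η := by
    calc _ ≤ δ * ((k + 1) * D) := mul_le_mul_of_nonneg_left (hlogw k) hδ0.le
      _ = (k + 1) * (δ * D) := by ring
      _ ≤ _ := mul_le_mul_of_nonneg_left hδD (by positivity)
  linarith

end

end NSFT

theorem theorem4p11 (S : NSFT) (hprim : S.Primitive)
    (wh vh : ∀ i, Fin (S.l i) → ℝ) (μ : ∀ k, Measure (S.Space k)) (hμ : S.IsParry wh vh μ) :
    Tendsto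
      (fun ε : ℝ => limsup (fun k : ℕ =>
        ((1 / (k : ℝ) * ∑ β, S.parryVec wh vh (S.nTilde ε k) β *
          Real.log (S.colSum (S.nTilde ε k) β) : ℝ) : EReal)) atTop)
      (𝓝[>] 0) (𝓝 (NDS.metricEntropy S.shift μ)) ∧
    ((∀ δ ∈ Set.Ioo (0 : ℝ) 1, ∃ ε : ℝ, 0 < ε ∧ ∃ k₀ : ℕ, ∀ k ≥ k₀, ∀ γ : Fin (S.l k),
        S.Maximizes k γ →
        ∃ B : Finset (Fin (S.l (S.nIdx ε k))),
          (∀ β ∈ B, 1 ≤ S.matProd (Nat.le_add_right k (S.mIdx ε k)) γ β) ∧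
          1 - δ ≤ ∑ β ∈ B, S.parryVec wh vh (S.nIdx ε k) β) →
      NDS.metricEntropy S.shift μ = NDS.topEntropy S.shift) := by
  by_cases hU : S.WordsUnbounded
  · refine ⟨?_, fun hs => le_antisymm (hμ.metricEntropy_le_topEntropy hU) ?_⟩
    · exact (hμ.tendsto_wordEntropy hU).congr fun ε => (hμ.limsup_meanLogColSum_eq ε).symm
    · exact (NSFT.topEntropy_le hU).trans
        (iSup₂_le fun ε hε => hμ.wordGrowth_le_metricEntropy hU hs hε)
  -- Here `m_k(ε)` may take its default value `0`, which is harmless: both entropies vanish on a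
  -- finite `Σ^0`, and the mean logarithms are bounded along every sequence of indices.
  · obtain ⟨B, hB⟩ := NSFT.exists_w_le_of_not_wordsUnbounded hU
    have := S.finite_space_of_w_le hB
    obtain ⟨K, hK⟩ := hμ.exists_meanLogColSum_le hB
    rw [hμ.metricEntropy_eq_zero, NSFT.topEntropy_eq_zero]
    refine ⟨tendsto_const_nhds.congr fun ε => ?_, fun _ => rfl⟩
    exact le_antisymm (NDS.limsup_div_nonneg fun k => hμ.meanLogColSum_nonneg _)
      (NDS.limsup_div_nonpos K fun k => hK _)
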